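/- **Setting.** Let $U$ be a universal machine: a partial recursive function $(p,y)\mapsto U(p,y)$ from pairs of binary strings to binary strings such that for every partial recursive $f$ of the same type there are a computable map $g$ on binary strings and a constant $c$ with $l(g(p))\le l(p)+c$ and $U(g(p),y)=f(p,y)$ for all $p,y$ (both sides being undefined for the same arguments); $l$ denotes length. Let $C(x\mid y)=\min\{\,l(p): U(p,y)=x\,\}$ be the conditional Kolmogorov complexity. A *decoder-only transformer* here has a finite vocabulary, consisting of a start token, the bits $0,1$, a separator, an answer token, an end token and finitely many further tokens, and finitely many rational parameters, and it computes with exact rationals. The $n$-th token ($n\ge 1$) is represented by its embedding plus a fixed linear image of $(n,n^2,1/n,1/n^2)$. Then come finitely many layers, each consisting of causally masked multi-head dot-product attention with hardmax (equal weights on the positions $\le n$ of maximal score) and a two-layer ReLU network, both with residual connections. An affine map of the last vector gives the logits, and the next token is the unique token of maximal logit; it is appended to the sequence and the process is repeated. On binary strings $s_1,\dots,s_k$ the prompt is the start token followed by $s_1,\dots,s_k$, each followed by the separator. The transformer *outputs* $m\in\mathbb N$ if it generates finitely many tokens other than the answer and end tokens, then the answer token, the binary digits of $m$ (least significant first), and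 the end token. **Corollary 4.2.** There is a total recursive function $M:\mathbb N\times\{0,1\}^*\times\{0,1\}^*\to\mathbb N$, nonincreasing in $t$, such that $$\lim_{t\to\infty}M(t,x,y)=C(x\mid y)\qquad\text{for all } x,y\in\{0,1\}^*,$$ and $M$ is computed by decoder-only transformers, in both of the following senses: there is a single decoder-only transformer that for all $t,x,y$ outputs $M(t,x,y)$ on the input $(t,x,y)$, with $t$ written in binary, least significant digit first; and there is a sequence $(T_t)_{t\ge 0}$ of decoder-only transformers such that for all $t,x,y$ the transformer $T_t$ outputs $M(t,x,y)$ on the input $(x,y)$. -/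

import Mathlib

open Filter Topology
open scoped Matrix

/-! ### Conditional Kolmogorov complexity -/

/-- A universal machine, seen as the partial function `U p y` (the output of program `p` on side
input `y`, undefined if the machine does not halt). It is partial recursive, and it simulates every
partial recursive `f`: programs `p` for `f` are effectively translated into programs `g p` for `U`
at the cost of at most a constant number of additional bits (for instance `g p = w ++ p`,
with `w` a self-delimiting description of a machine for `f`). -/
structure IsUniversalMachine (U : List Bool → List Bool →. List Bool) : Prop where
  partrec : Partrec₂ U
  simulates : ∀ f : List Bool → List Bool →. List Bool, Partrec₂ f →
    ∃ (g : List Bool → List Bool) (c : ℕ), Computable g ∧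
      (∀ p, (g p).length ≤ p.length + c) ∧ ∀ p y, U (g p) y = f p y

/-- `C_U(x | y)`, the length of a shortest program `p` with `U(p, y) = x`. For a universal `U`
such a program exists for all `x`, `y`. -/
noncomputable def condComplexity (U : List Bool → List Bool →. List Bool)
    (x y : List Bool) : ℕ :=
  sInf {n : ℕ | ∃ p : List Bool, x ∈ U p y ∧ p.length = n}

/-! ### Decoder-only transformers with rational arithmetic and hardmax attention

Coordinates of vectors are indexed by finite types; the dimension of the model is the cardinality
of the index type `ι`. A sequence of vectors is a function `ℕ → ι → ℚ` of the (zero-based) position;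
by causal masking the vectors computed at position `i` depend on the positions `j ≤ i` only, so that
for a token sequence of length `n` the values at positions `≥ n` are irrelevant. -/

/-- One attention head: query, key, value and output matrices. -/
structure AttentionHead (ι : Type) where
  κ : Type
  [fintypeκ : Fintype κ]
  Q : Matrix κ ι ℚ
  K : Matrix κ ι ℚ
  V : Matrix κ ι ℚ
  O : Matrix ι κ ℚ

attribute [instance] AttentionHead.fintypeκ

namespace AttentionHead

variable {ι : Type} [Fintype ι]

/-- Dot-product score `⟨Q xᵢ, K xⱼ⟩`. (A positive scaling factor has no effect on hardmax.) -/
def score (h : AttentionHead ι) (x : ℕ → ι → ℚ) (i j : ℕ) : ℚ :=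
  (h.Q *ᵥ x i) ⬝ᵥ (h.K *ᵥ x j)

/-- The positions `j ≤ i` of maximal score for the query at position `i`. -/
def maximizers (h : AttentionHead ι) (x : ℕ → ι → ℚ) (i : ℕ) : Finset ℕ :=
  (Finset.range (i + 1)).filter fun j => ∀ k ≤ i, h.score x i k ≤ h.score x i j

/-- Causally masked hardmax attention: the weight is shared equally among the positions of
maximal score. -/
def apply (h : AttentionHead ι) (x : ℕ → ι → ℚ) (i : ℕ) : ι → ℚ :=
  h.O *ᵥ (((h.maximizers x i).card : ℚ)⁻¹ • ∑ j ∈ h.maximizers x i, h.V *ᵥ x j)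

end AttentionHead

/-- One transformer block: multi-head attention and a two-layer ReLU network. -/
structure DecoderLayer (ι : Type) where
  heads : List (AttentionHead ι)
  μ : Type
  [fintypeμ : Fintype μ]
  W₁ : Matrix μ ι ℚ
  b₁ : μ → ℚ
  W₂ : Matrix ι μ ℚ
  b₂ : ι → ℚ

attribute [instance] DecoderLayer.fintypeμ

namespace DecoderLayer

variable {ι : Type} [Fintype ι]

/-- Multi-head attention with residual connection. -/
def attention (L : DecoderLayer ι) (x : ℕ → ι → ℚ) (i : ℕ) : ι → ℚ :=
  x i + (L.heads.map fun h => h.apply x i).sum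

/-- The position-wise feed-forward network `v ↦ W₂ relu(W₁ v + b₁) + b₂`. -/
def feedForward (L : DecoderLayer ι) (v : ι → ℚ) : ι → ℚ :=
  L.W₂ *ᵥ (fun m => max 0 ((L.W₁ *ᵥ v + L.b₁) m)) + L.b₂

/-- The block: attention, then feed-forward network, both with residual connections. -/
def apply (L : DecoderLayer ι) (x : ℕ → ι → ℚ) (i : ℕ) : ι → ℚ :=
  L.attention x i + L.feedForward (L.attention x i)

end DecoderLayer

/-- Tokens used for input and output: the start token, the bits, a separator that ends each
input string, a token announcing the answer, and the end token. -/
inductive BaseToken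
  | bos
  | bit (b : Bool)
  | sep
  | ans
  | eos
  deriving DecidableEq, Fintype

/-- The rational positional features of the `n`-th token, `n = 1, 2, …`. -/
def positionFeatures (n : ℕ) : Fin 4 → ℚ :=
  ![(n : ℚ), (n : ℚ) ^ 2, 1 / (n : ℚ), 1 / (n : ℚ) ^ 2]

/-- A decoder-only transformer with rational parameters. Its vocabulary consists of the base tokens
and a finite set `S` of further tokens. -/
structure DecoderOnlyTransformer where
  S : Type
  [fintypeS : Fintype S]
  ι : Type
  [fintypeι : Fintype ι]
  /-- token embedding -/
  embed : BaseToken ⊕ S → ι → ℚ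
  /-- linear map applied to the positional features -/
  pos : Matrix ι (Fin 4) ℚ
  layers : List (DecoderLayer ι)
  /-- output matrix and bias producing the logits -/
  unembed : Matrix (BaseToken ⊕ S) ι ℚ
  bias : BaseToken ⊕ S → ℚ

attribute [instance] DecoderOnlyTransformer.fintypeS DecoderOnlyTransformer.fintypeι

namespace DecoderOnlyTransformer

/-- The vocabulary. -/
abbrev Token (T : DecoderOnlyTransformer) : Type := BaseToken ⊕ T.S

/-- Token embedding plus positional encoding. (The value at positions past the end of `w` is
immaterial.) -/
def input (T : DecoderOnlyTransformer) (w : List T.Token) (i : ℕ) : T.ι → ℚ :=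
  (w[i]?).elim 0 T.embed + T.pos *ᵥ positionFeatures (i + 1)

/-- The vectors after all layers, which are applied in the order of the list. -/
def hidden (T : DecoderOnlyTransformer) (w : List T.Token) : ℕ → T.ι → ℚ :=
  T.layers.foldl (fun x L => L.apply x) (T.input w)

/-- Next-token logits after reading the nonempty token sequence `w`: read off at its last token. -/
def logits (T : DecoderOnlyTransformer) (w : List T.Token) : T.Token → ℚ :=
  T.unembed *ᵥ T.hidden w (w.length - 1) + T.bias

/-- `v` is the next token after `w`: the unique token of maximal logit (greedy decoding). -/
def IsNext (T : DecoderOnlyTransformer) (w : List T.Token) (v : T.Token) : Prop :=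
  ∀ u, u ≠ v → T.logits w u < T.logits w v

/-- Autoregressive generation: started on `w`, the transformer successively generates the listed
tokens, each being appended to the sequence before the next one is predicted. -/
def Generates (T : DecoderOnlyTransformer) : List T.Token → List T.Token → Prop
  | _, [] => True
  | w, v :: vs => T.IsNext w v ∧ T.Generates (w ++ [v]) vs

/-- A binary string as a list of tokens. -/
def bitTokens (T : DecoderOnlyTransformer) (s : List Bool) : List T.Token :=
  s.map fun b => Sum.inl (BaseToken.bit b)

/-- The prompt for a list of binary strings: the start token, then each string followed by the
separator. -/
def prompt (T : DecoderOnlyTransformer) (args : List (List Bool)) : List T.Token :=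
  Sum.inl BaseToken.bos :: args.flatMap fun s => T.bitTokens s ++ [Sum.inl BaseToken.sep]

/-- On input `args` the transformer halts with output `n`: it generates finitely many intermediate
tokens, then the answer token, the binary expansion of `n` (least significant bit first), and
the end token. -/
def Outputs (T : DecoderOnlyTransformer) (args : List (List Bool)) (n : ℕ) : Prop :=
  ∃ scratch : List T.Token,
    Sum.inl BaseToken.ans ∉ scratch ∧ Sum.inl BaseToken.eos ∉ scratch ∧
    T.Generates (T.prompt args)
      (scratch ++ Sum.inl BaseToken.ans :: T.bitTokens (Nat.bits n) ++ [Sum.inl BaseToken.eos])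

end DecoderOnlyTransformer

/-!
The complexity `C(x | y)` is approximated from above by a primitive recursive function
(`approx`, `primrec_approx`). The first bound is `l(x) + d`, where `d` is the overhead of simulating
the machine that outputs its program. At stage `t`, one pair of a program and a step bound, encoded
by `t`, is tried, and the bound is lowered if this yields `x`. A shortest program is
tried eventually, so the limit is `C(x | y)`. It therefore suffices that every primitive recursive
function of a list of binary strings is output by a transformer
(`exists_transformer_of_primrec`); for the sequence of transformers, `t` is a constant of that
function.

*Transformers simulate pointers* (`PointerMachine.isNext_step`). Assign an integer weight to every
token. Uniform attention computes the sum `c` of the weights of the `n` tokens seen so far, divided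
by `n`. Since `1 / n` is available as well, a head of the next layer can use the scores
`((c + 1) ^ 2 - (j - c) ^ 2) / n`, whose maximum over the positions `j` is attained at `j = c` only,
and hence retrieves the token at position `c`. A feed-forward network with one unit for each
combination of the last token and the tokens retrieved tabulates the next token.

*Pointers are counters* (`CounterProgram.generates_run`). If the tokens are the states of a counter
program, weighted by their effect on a counter, then `c` is the value of the counter. As the start
token is only at position `0`, retrieving the token at position `c` is a test for zero, and it
allows counter programs to read the prompt. Counter programs compute all primitive recursive
functions (`CounterProgram.isCounterComputable_of_primrec`).

*Output in binary* (`CounterProgram.generates_blocks`). No scratch tokens may occur between the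
digits of the result `m`. Therefore, the numbers `0, 1, …, m` are first written down in binary one
after another, each by copying the preceding digits with a carry. The digit to be copied is found by
a pointer that stays behind by the length of a block: it is moved by `1` by each token, except
those by which blocks grow. The same pointer then copies the digits of `m` to the output.
-/

/-! ### Transformers that retrieve tokens by pointers -/

theorem AttentionHead.apply_eq {ι : Type} [Fintype ι] (h : AttentionHead ι) (x : ℕ → ι → ℚ)
    (i : ℕ) (c : ι) :
    h.apply x i c = ((h.maximizers x i).card : ℚ)⁻¹ *
      ∑ j ∈ h.maximizers x i, h.O c ⬝ᵥ fun r => h.V r ⬝ᵥ x j := by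
  simp only [AttentionHead.apply, Matrix.mulVec, dotProduct_smul, dotProduct_sum, smul_eq_mul]
  rfl

theorem DecoderLayer.feedForward_eq {ι : Type} [Fintype ι] (L : DecoderLayer ι) (v : ι → ℚ)
    (c : ι) :
    L.feedForward v c = ∑ m, L.W₂ c m * max 0 (L.W₁ m ⬝ᵥ v + L.b₁ m) + L.b₂ c :=
  rfl

/-- A finite rule for generating tokens, based on pointers. Every token moves the pointer `k` by
`weight k`. The next token depends on the last token and on the tokens that the pointers
point to. -/
structure PointerMachine where
  S : Type
  [fintypeS : Fintype S]
  κ : Type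
  [fintypeκ : Fintype κ]
  weight : κ → BaseToken ⊕ S → ℤ
  next : BaseToken ⊕ S → (κ → BaseToken ⊕ S) → BaseToken ⊕ S

attribute [instance] PointerMachine.fintypeS PointerMachine.fintypeκ

namespace PointerMachine

/-- The vocabulary. -/
abbrev Token (M : PointerMachine) : Type := BaseToken ⊕ M.S

/-- The value of the pointer `k` after the tokens `w`. -/
def pointer (M : PointerMachine) (w : List M.Token) (k : M.κ) : ℤ :=
  (w.map (M.weight k)).sum

/-- The zero-based position that the pointer `k` points to. Pointers that leave the sequence are
moved to its closest position. -/
def target (M : PointerMachine) (w : List M.Token) (k : M.κ) : ℕ :=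
  min (M.pointer w k).toNat (w.length - 1)

/-- The token that the pointer `k` points to. (The default value is immaterial, since
sequences are nonempty.) -/
def look (M : PointerMachine) (w : List M.Token) (k : M.κ) : M.Token :=
  w.getD (M.target w k) (Sum.inl BaseToken.bos)

/-- The token that follows the sequence `w`. -/
def step (M : PointerMachine) (w : List M.Token) : M.Token :=
  M.next (w.getLastD (Sum.inl BaseToken.bos)) (M.look w)

/-- Started on the first list, the machine generates the second one. -/
def Generates (M : PointerMachine) : List M.Token → List M.Token → Prop
  | _, [] => True
  | w, v :: vs => M.step w = v ∧ M.Generates (w ++ [v]) vs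

/-- Coordinates of the vectors of the transformer that simulates a pointer machine: the one-hot
encoding of the token, the pointers (divided by the number of tokens), the one-hot encodings of the
tokens that are pointed to, the one-hot encoding of the next token, the positional features. -/
inductive Coord (V κ : Type)
  | tok (v : V)
  | ptr (k : κ)
  | look (k : κ) (v : V)
  | out (v : V)
  | feat (i : Fin 4)
  deriving DecidableEq, Fintype

open Classical in
/-- Uniform attention, which averages the weights of the tokens seen so far: the pointers divided
by the number of tokens. -/
noncomputable abbrev averageHead (M : PointerMachine) : AttentionHead (Coord M.Token M.κ) where
  κ := M.κ
  Q := 0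
  K := 0
  V := Matrix.of fun k => ∑ v, Pi.single (Coord.tok v) (M.weight k v : ℚ)
  O := Matrix.of fun c => match c with
    | Coord.ptr k => Pi.single k 1
    | _ => 0

open Classical in
/-- The head that attends to the position of the pointer `k`. With `c` the pointer and `n` the
number of tokens, the score of the zero-based position `j` is
`(2 (c + 1) (j + 1) - (j + 1) ^ 2) / n = ((c + 1) ^ 2 - (j - c) ^ 2) / n`. -/
noncomputable abbrev lookHead (M : PointerMachine) (k : M.κ) :
    AttentionHead (Coord M.Token M.κ) where
  κ := Bool ⊕ M.Token
  Q := Matrix.of fun r => match r with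
    | Sum.inl false => Pi.single (Coord.ptr k) 1 + Pi.single (Coord.feat 2) 1
    | Sum.inl true => Pi.single (Coord.feat 2) 1
    | Sum.inr _ => 0
  K := Matrix.of fun r => match r with
    | Sum.inl false => Pi.single (Coord.feat 0) 2
    | Sum.inl true => Pi.single (Coord.feat 1) (-1)
    | Sum.inr _ => 0
  V := Matrix.of fun r => match r with
    | Sum.inl _ => 0
    | Sum.inr v => Pi.single (Coord.tok v) 1
  O := Matrix.of fun c => match c with
    | Coord.look k' v => if k' = k then Pi.single (Sum.inr v) 1 else 0
    | _ => 0

/-- The layer that computes the pointers. Its feed-forward network is zero. -/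
noncomputable abbrev averageLayer (M : PointerMachine) : DecoderLayer (Coord M.Token M.κ) where
  heads := [M.averageHead]
  μ := Empty
  W₁ := 0
  b₁ := 0
  W₂ := 0
  b₂ := 0

open Classical in
/-- The layer that looks up the tokens pointed to. Its feed-forward network tabulates
`PointerMachine.next`, with one unit for each argument `(v, f)`. -/
noncomputable abbrev lookLayer (M : PointerMachine) : DecoderLayer (Coord M.Token M.κ) where
  heads := (Finset.univ : Finset M.κ).toList.map M.lookHead
  μ := M.Token × (M.κ → M.Token)
  W₁ := Matrix.of fun a => Pi.single (Coord.tok a.1) 1 + ∑ k, Pi.single (Coord.look k (a.2 k)) 1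
  b₁ := fun _ => -(Fintype.card M.κ : ℚ)
  W₂ := Matrix.of fun c => match c with
    | Coord.out u => fun a => if M.next a.1 a.2 = u then 1 else 0
    | _ => 0
  b₂ := 0

open Classical in
/-- The transformer that simulates a pointer machine. -/
noncomputable abbrev toTransformer (M : PointerMachine) : DecoderOnlyTransformer where
  S := M.S
  ι := Coord M.Token M.κ
  embed := fun v => Pi.single (Coord.tok v) 1
  pos := Matrix.of fun c => match c with
    | Coord.feat i => Pi.single i 1
    | _ => 0
  layers := [M.averageLayer, M.lookLayer]
  unembed := Matrix.of fun u => Pi.single (Coord.out u) 1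
  bias := 0

open Classical in
theorem input_tok (M : PointerMachine) (w : List M.Token) {i : ℕ} (hi : i < w.length)
    (v : M.Token) :
    M.toTransformer.input w i (Coord.tok v) = if v = w[i] then 1 else 0 := by
  change (w[i]?).elim (0 : Coord M.Token M.κ → ℚ) (fun u => Pi.single (Coord.tok u) 1)
    (Coord.tok v) +
    (0 : Fin 4 → ℚ) ⬝ᵥ positionFeatures (i + 1) = _
  simp [hi, Pi.single_apply]

theorem elim_embed_of_ne {V κ : Type} [DecidableEq (Coord V κ)] (a : Option V) (c : Coord V κ)
    (hc : ∀ v, c ≠ Coord.tok v) :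
    a.elim (0 : Coord V κ → ℚ) (fun u => Pi.single (Coord.tok u) 1) c = 0 := by
  cases a <;> simp [hc]

theorem input_feat (M : PointerMachine) (w : List M.Token) (i : ℕ) (r : Fin 4) :
    M.toTransformer.input w i (Coord.feat r) = positionFeatures (i + 1) r := by
  classical
  change (w[i]?).elim (0 : Coord M.Token M.κ → ℚ) (fun u => Pi.single (Coord.tok u) 1)
    (Coord.feat r) +
    (Pi.single r 1 : Fin 4 → ℚ) ⬝ᵥ positionFeatures (i + 1) = _
  rw [elim_embed_of_ne _ _ (by simp)]
  simp

theorem input_eq_zero (M : PointerMachine) (w : List M.Token) (i : ℕ) (c : Coord M.Token M.κ)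
    (h : ∀ v, c ≠ Coord.tok v) (h' : ∀ r, c ≠ Coord.feat r) :
    M.toTransformer.input w i c = 0 := by
  classical
  have hc : M.toTransformer.pos c = 0 := by
    cases c <;> first | rfl | simp_all
  change (w[i]?).elim (0 : Coord M.Token M.κ → ℚ) (fun u => Pi.single (Coord.tok u) 1) c +
    M.toTransformer.pos c ⬝ᵥ positionFeatures (i + 1) = _
  rw [elim_embed_of_ne _ _ h, hc]
  simp

theorem averageHead_apply_ptr (M : PointerMachine) (x : ℕ → Coord M.Token M.κ → ℚ) (i : ℕ)
    (k : M.κ) :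
    M.averageHead.apply x i (Coord.ptr k) =
      ((i : ℚ) + 1)⁻¹ *
        ∑ j ∈ Finset.range (i + 1), ∑ v, (M.weight k v : ℚ) * x j (Coord.tok v) := by
  classical
  have hs : ∀ i j, M.averageHead.score x i j = 0 := by
    intro i j
    change ((0 : Matrix M.κ (Coord M.Token M.κ) ℚ) *ᵥ x i) ⬝ᵥ
      ((0 : Matrix M.κ (Coord M.Token M.κ) ℚ) *ᵥ x j) = 0
    simp
  have hm : M.averageHead.maximizers x i = Finset.range (i + 1) := by
    simp [AttentionHead.maximizers, hs]
  rw [AttentionHead.apply_eq, hm]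
  change _ * ∑ j ∈ _, (Pi.single k 1 : M.κ → ℚ) ⬝ᵥ
    (fun r => (∑ v, Pi.single (Coord.tok v) (M.weight r v : ℚ)) ⬝ᵥ x j) = _
  simp only [single_dotProduct, sum_dotProduct, Finset.card_range, one_mul, Nat.cast_add,
    Nat.cast_one]

theorem averageHead_apply_of_ne (M : PointerMachine) (x : ℕ → Coord M.Token M.κ → ℚ) (i : ℕ)
    (c : Coord M.Token M.κ) (hc : ∀ k, c ≠ Coord.ptr k) :
    M.averageHead.apply x i c = 0 := by
  have h : M.averageHead.O c = 0 := by
    cases c <;> first | rfl | simp_all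
  rw [AttentionHead.apply_eq, h]
  simp

theorem averageLayer_apply (M : PointerMachine) (x : ℕ → Coord M.Token M.κ → ℚ) (i : ℕ) :
    M.averageLayer.apply x i = x i + M.averageHead.apply x i := by
  have h : M.averageLayer.feedForward (M.averageLayer.attention x i) = 0 := by
    funext c
    change (0 : Empty → ℚ) ⬝ᵥ _ + 0 = 0
    rw [zero_dotProduct, add_zero]
  rw [DecoderLayer.apply, h]
  simp [DecoderLayer.attention]

/-- Among the positions `0, …, i`, the one closest to the integer `c` is unique. -/
theorem closest_unique (c : ℤ) (i j : ℕ) (hj : j ≤ i) (hne : j ≠ min c.toNat i) :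
    2 * (c + 1) * ((j : ℤ) + 1) - ((j : ℤ) + 1) ^ 2 <
      2 * (c + 1) * ((min c.toNat i : ℕ) + 1) - (((min c.toNat i : ℕ) : ℤ) + 1) ^ 2 := by
  set a := min c.toNat i with ha
  -- the product is the difference of the sides, `(j - c) ^ 2 - (a - c) ^ 2`
  have key : 0 < ((j : ℤ) - a) * (j + a - 2 * c) := by
    rcases lt_or_gt_of_ne hne with h | h
    · exact mul_pos_of_neg_of_neg (by omega) (by omega)
    · exact mul_pos (by omega) (by omega)
  nlinarith

theorem lookHead_score (M : PointerMachine) (x : ℕ → Coord M.Token M.κ → ℚ) (k : M.κ)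
    (i j : ℕ) :
    (M.lookHead k).score x i j =
      (x i (Coord.ptr k) + x i (Coord.feat 2)) * (2 * x j (Coord.feat 0)) -
        x i (Coord.feat 2) * x j (Coord.feat 1) := by
  classical
  change ∑ r : Bool ⊕ M.Token, ((M.lookHead k).Q r ⬝ᵥ x i) * ((M.lookHead k).K r ⬝ᵥ x j) = _
  rw [Fintype.sum_sum_type, Fintype.sum_bool]
  change (Pi.single (Coord.feat 2) 1 ⬝ᵥ x i) * (Pi.single (Coord.feat 1) (-1) ⬝ᵥ x j) +
    ((Pi.single (Coord.ptr k) 1 + Pi.single (Coord.feat 2) 1) ⬝ᵥ x i) *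
      (Pi.single (Coord.feat 0) 2 ⬝ᵥ x j) +
    ∑ r : M.Token, ((0 : Coord M.Token M.κ → ℚ) ⬝ᵥ x i) *
      ((0 : Coord M.Token M.κ → ℚ) ⬝ᵥ x j) = _
  simp only [single_dotProduct, add_dotProduct, zero_dotProduct, mul_zero, Finset.sum_const_zero]
  ring

open Classical in
theorem lookHead_apply_look (M : PointerMachine) (x : ℕ → Coord M.Token M.κ → ℚ) (k k' : M.κ)
    (i a : ℕ) (h : (M.lookHead k).maximizers x i = {a}) (v : M.Token) :
    (M.lookHead k).apply x i (Coord.look k' v) = if k' = k then x a (Coord.tok v) else 0 := by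
  have hO : (M.lookHead k).O (Coord.look k' v) =
      if k' = k then (Pi.single (Sum.inr v) 1 : Bool ⊕ M.Token → ℚ) else 0 := rfl
  rw [AttentionHead.apply_eq, h, hO, Finset.sum_singleton]
  split_ifs
  · change _ * ((Pi.single (Sum.inr v) 1 : Bool ⊕ M.Token → ℚ) ⬝ᵥ _) = _
    rw [single_dotProduct]
    change _ * (_ * (Pi.single (Coord.tok v) 1 ⬝ᵥ x a)) = _
    rw [single_dotProduct]
    simp
  · change _ * ((0 : Bool ⊕ M.Token → ℚ) ⬝ᵥ _) = _
    simp

theorem lookHead_apply_of_ne (M : PointerMachine) (x : ℕ → Coord M.Token M.κ → ℚ) (k : M.κ)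
    (i : ℕ) (c : Coord M.Token M.κ) (hc : ∀ k v, c ≠ Coord.look k v) :
    (M.lookHead k).apply x i c = 0 := by
  have h : (M.lookHead k).O c = 0 := by
    cases c <;> first | rfl | simp_all
  rw [AttentionHead.apply_eq, h]
  simp

/-- The vectors after the first layer. -/
noncomputable def middle (M : PointerMachine) (w : List M.Token) : ℕ → Coord M.Token M.κ → ℚ :=
  M.averageLayer.apply (M.toTransformer.input w)

open Classical in
theorem middle_tok (M : PointerMachine) (w : List M.Token) {i : ℕ} (hi : i < w.length)
    (v : M.Token) : M.middle w i (Coord.tok v) = if v = w[i] then 1 else 0 := by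
  rw [middle, averageLayer_apply, Pi.add_apply, averageHead_apply_of_ne _ _ _ _ (by simp),
    add_zero, M.input_tok w hi]

theorem middle_feat (M : PointerMachine) (w : List M.Token) (i : ℕ) (r : Fin 4) :
    M.middle w i (Coord.feat r) = positionFeatures (i + 1) r := by
  rw [middle, averageLayer_apply, Pi.add_apply, averageHead_apply_of_ne _ _ _ _ (by simp),
    add_zero, input_feat]

theorem middle_eq_zero (M : PointerMachine) (w : List M.Token) (i : ℕ) (c : Coord M.Token M.κ)
    (h : ∀ v, c ≠ Coord.tok v) (h' : ∀ r, c ≠ Coord.feat r) (h'' : ∀ k, c ≠ Coord.ptr k) :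
    M.middle w i c = 0 := by
  rw [middle, averageLayer_apply, Pi.add_apply, averageHead_apply_of_ne _ _ _ _ h'',
    add_zero, input_eq_zero _ _ _ _ h h']

theorem middle_ptr (M : PointerMachine) (w : List M.Token) {i : ℕ} (hi : i + 1 = w.length)
    (k : M.κ) : M.middle w i (Coord.ptr k) = ((i : ℚ) + 1)⁻¹ * M.pointer w k := by
  classical
  rw [middle, averageLayer_apply, Pi.add_apply, averageHead_apply_ptr,
    input_eq_zero _ _ _ _ (by simp) (by simp), zero_add]
  congr 1
  rw [pointer, ← Fin.sum_univ_fun_getElem, Int.cast_sum, hi, Finset.sum_range]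
  refine Finset.sum_congr rfl fun j _ => ?_
  simp only [M.input_tok w j.2, mul_ite, mul_one, mul_zero]
  rw [Finset.sum_ite_eq']
  simp

theorem lookHead_maximizers (M : PointerMachine) (w : List M.Token) (hw : w ≠ []) (k : M.κ) :
    (M.lookHead k).maximizers (M.middle w) (w.length - 1) = {M.target w k} := by
  obtain ⟨i, hi⟩ : ∃ i, i + 1 = w.length :=
    ⟨w.length - 1, Nat.sub_add_cancel (List.length_pos_iff.2 hw)⟩
  have hi' : w.length - 1 = i := by omega
  have hlt : ∀ j ≤ i, j ≠ M.target w k →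
      (M.lookHead k).score (M.middle w) i j <
        (M.lookHead k).score (M.middle w) i (M.target w k) := by
    intro j hj hne
    rw [target, hi'] at hne ⊢
    have h := closest_unique (M.pointer w k) i j hj hne
    have h2 : (2 * ((M.pointer w k : ℚ) + 1) * ((j : ℚ) + 1) - ((j : ℚ) + 1) ^ 2) <
      2 * ((M.pointer w k : ℚ) + 1) * ((min (M.pointer w k).toNat i : ℕ) + 1) -
        (((min (M.pointer w k).toNat i : ℕ) : ℚ) + 1) ^ 2 := by
      exact_mod_cast h
    have h3 : (0 : ℚ) < ((i : ℚ) + 1)⁻¹ := by positivity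
    have h4 := mul_lt_mul_of_pos_left h2 h3
    rw [lookHead_score, lookHead_score, middle_ptr M w hi]
    simp only [middle_feat, positionFeatures]
    simp only [Matrix.cons_val, Nat.cast_add, Nat.cast_one, one_div]
    nlinarith
  have hmem : M.target w k ≤ i := by
    rw [target, hi']
    exact min_le_right _ _
  rw [hi']
  ext j
  simp only [AttentionHead.maximizers, Finset.mem_filter, Finset.mem_range, Finset.mem_singleton]
  constructor
  · rintro ⟨hj, hmax⟩
    by_contra hne
    exact absurd (hlt j (by omega) hne) (not_lt.2 (hmax _ hmem))
  · rintro rfl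
    refine ⟨by omega, fun j hj => ?_⟩
    by_cases hne : j = M.target w k
    · rw [hne]
    · exact (hlt j hj hne).le

theorem lookLayer_attention (M : PointerMachine) (x : ℕ → Coord M.Token M.κ → ℚ) (i : ℕ)
    (c : Coord M.Token M.κ) :
    M.lookLayer.attention x i c = x i c + ∑ k, (M.lookHead k).apply x i c := by
  rw [DecoderLayer.attention, Pi.add_apply]
  congr 1
  simp only [List.map_map]
  rw [Finset.sum_map_toList]
  simp

open Classical in
theorem attention_tok (M : PointerMachine) (w : List M.Token) (hw : w ≠ []) (v : M.Token) :
    M.lookLayer.attention (M.middle w) (w.length - 1) (Coord.tok v) =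
      if v = w.getLastD (Sum.inl BaseToken.bos) then 1 else 0 := by
  have hl : w.length - 1 < w.length := Nat.sub_lt (List.length_pos_iff.2 hw) one_pos
  rw [lookLayer_attention, M.middle_tok w hl, Finset.sum_eq_zero, add_zero]
  · rw [List.getLastD_eq_getLast?, List.getLast?_eq_getElem?, List.getElem?_eq_getElem hl]
    rfl
  · intro k _
    exact lookHead_apply_of_ne _ _ _ _ _ (by simp)

open Classical in
theorem attention_look (M : PointerMachine) (w : List M.Token) (hw : w ≠ []) (k : M.κ)
    (v : M.Token) :
    M.lookLayer.attention (M.middle w) (w.length - 1) (Coord.look k v) =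
      if v = M.look w k then 1 else 0 := by
  have hl : M.target w k < w.length :=
    lt_of_le_of_lt (min_le_right _ _) (Nat.sub_lt (List.length_pos_iff.2 hw) one_pos)
  rw [lookLayer_attention, middle_eq_zero _ _ _ _ (by simp) (by simp) (by simp), zero_add]
  simp only [lookHead_apply_look M (M.middle w) _ _ _ _ (M.lookHead_maximizers w hw _)]
  rw [Finset.sum_ite_eq]
  simp [M.middle_tok w hl, look, hl]

theorem attention_out (M : PointerMachine) (w : List M.Token) (v : M.Token) :
    M.lookLayer.attention (M.middle w) (w.length - 1) (Coord.out v) = 0 := by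
  rw [lookLayer_attention, middle_eq_zero _ _ _ _ (by simp) (by simp) (by simp), zero_add]
  exact Finset.sum_eq_zero fun k _ => lookHead_apply_of_ne _ _ _ _ _ (by simp)

open Classical in
/-- The unit for `(v, f)` is active exactly if `v` is the last token and `f` lists the tokens
pointed to. -/
theorem unit_eq (M : PointerMachine) (w : List M.Token) (hw : w ≠ [])
    (a : M.Token × (M.κ → M.Token)) :
    max 0 (M.lookLayer.attention (M.middle w) (w.length - 1) (Coord.tok a.1) +
      ∑ k, M.lookLayer.attention (M.middle w) (w.length - 1) (Coord.look k (a.2 k)) -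
        (Fintype.card M.κ : ℚ)) =
      if a = (w.getLastD (Sum.inl BaseToken.bos), M.look w) then 1 else 0 := by
  obtain ⟨v, f⟩ := a
  simp only [M.attention_tok w hw, M.attention_look w hw]
  split_ifs with h1 h2 h2
  · have hf : ∀ k, f k = M.look w k := fun k => congrFun (Prod.ext_iff.1 h2).2 k
    simp [hf]
  · have hf : ∃ k, f k ≠ M.look w k := by
      by_contra! hf
      exact h2 (Prod.ext h1 (funext hf))
    obtain ⟨k, hk⟩ := hf
    have hle : ∑ k, (if f k = M.look w k then (1 : ℚ) else 0) ≤ Fintype.card M.κ - 1 := by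
      rw [← Finset.add_sum_erase _ _ (Finset.mem_univ k), if_neg hk, zero_add]
      refine (Finset.sum_le_card_nsmul _ _ 1 fun k _ => ?_).trans ?_
      · split_ifs <;> norm_num
      · rw [Finset.card_erase_of_mem (Finset.mem_univ k), Finset.card_univ, nsmul_eq_mul,
          Nat.cast_pred (Fintype.card_pos_iff.2 ⟨k⟩), mul_one]
    exact max_eq_left (by linarith)
  · exact absurd (Prod.ext_iff.1 h2).1 h1
  · have hle : ∑ k, (if f k = M.look w k then (1 : ℚ) else 0) ≤ Fintype.card M.κ := by
      refine (Finset.sum_le_card_nsmul _ _ 1 fun k _ => ?_).trans ?_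
      · split_ifs <;> norm_num
      · simp
    exact max_eq_left (by linarith)

open Classical in
theorem lookLayer_feedForward_out (M : PointerMachine) (z : Coord M.Token M.κ → ℚ)
    (u : M.Token) :
    M.lookLayer.feedForward z (Coord.out u) =
      ∑ a : M.Token × (M.κ → M.Token), (if M.next a.1 a.2 = u then (1 : ℚ) else 0) *
        max 0 (z (Coord.tok a.1) + ∑ k, z (Coord.look k (a.2 k)) - (Fintype.card M.κ : ℚ)) := by
  have h : ∀ a : M.Token × (M.κ → M.Token), M.lookLayer.W₁ a ⬝ᵥ z =
      z (Coord.tok a.1) + ∑ k, z (Coord.look k (a.2 k)) := by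
    intro a
    change (Pi.single (Coord.tok a.1) 1 + ∑ k, Pi.single (Coord.look k (a.2 k)) 1) ⬝ᵥ z = _
    simp only [add_dotProduct, sum_dotProduct, single_dotProduct, one_mul]
  rw [DecoderLayer.feedForward_eq]
  simp only [h]
  change _ + (0 : ℚ) = _
  simp only [add_zero, sub_eq_add_neg]
  rfl

open Classical in
theorem logits_eq (M : PointerMachine) (w : List M.Token) (hw : w ≠ []) (u : M.Token) :
    M.toTransformer.logits w u = if M.step w = u then 1 else 0 := by
  change Pi.single (Coord.out u) (1 : ℚ) ⬝ᵥ
    M.lookLayer.apply (M.middle w) (w.length - 1) + 0 = _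
  rw [single_dotProduct, one_mul, add_zero, DecoderLayer.apply, Pi.add_apply, attention_out,
    zero_add, lookLayer_feedForward_out]
  simp only [M.unit_eq w hw, mul_ite, mul_one, mul_zero]
  rw [Finset.sum_ite_eq' Finset.univ]
  simp [step]

theorem isNext_step (M : PointerMachine) (w : List M.Token) (hw : w ≠ []) :
    M.toTransformer.IsNext w (M.step w) := by
  classical
  intro u hu
  rw [M.logits_eq w hw, M.logits_eq w hw, if_neg (Ne.symm hu), if_pos rfl]
  exact one_pos

theorem Generates.toTransformer {M : PointerMachine} {w vs : List M.Token} (hw : w ≠ [])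
    (h : M.Generates w vs) : M.toTransformer.Generates w vs := by
  induction vs generalizing w with
  | nil => trivial
  | cons v vs ih =>
    obtain ⟨rfl, h⟩ := h
    exact ⟨M.isNext_step w hw, ih (by simp) h⟩

theorem Generates.append {M : PointerMachine} {w us vs : List M.Token} (h : M.Generates w us)
    (h' : M.Generates (w ++ us) vs) : M.Generates w (us ++ vs) := by
  induction us generalizing w with
  | nil => simpa using h'
  | cons u us ih => exact ⟨h.1, ih h.2 (by simpa using h')⟩

end PointerMachine

/-! ### Counter programs -/

/-- A flat program over the counters `0, 1, 2, …`. On entering the state `q`, the program adds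
`(act q).2` to the counter `(act q).1`; then it reads the prompt at the position given by the
counter `test q` and moves to the state `nxt q s`, with `s` the symbol read (`none` past the end of
the prompt, and the first symbol for a negative counter). It halts if there is no such state. Since
the start token is at position `0` and only there, a nonnegative counter is zero if and only if the
symbol read is the start token. -/
structure CounterProgram where
  Q : Type
  [fintypeQ : Fintype Q]
  entry : Q
  act : Q → ℕ × ℤ
  test : Q → ℕ
  nxt : Q → Option BaseToken → Option Q

attribute [instance] CounterProgram.fintypeQ

namespace CounterProgram

/-- The effect of an action on the counters. -/
def upd (σ : ℕ → ℤ) (a : ℕ × ℤ) : ℕ → ℤ :=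
  Function.update σ a.1 (σ a.1 + a.2)

/-- The symbol of the prompt `P` at the position given by the counter `k`. -/
def read (P : List BaseToken) (σ : ℕ → ℤ) (k : ℕ) : Option BaseToken :=
  P[(σ k).toNat]?

/-- `A.Run P q σ τ`: in state `q`, with the counters `σ` reached after the action of `q`, the
program halts with the counters `τ`. -/
inductive Run (A : CounterProgram) (P : List BaseToken) : A.Q → (ℕ → ℤ) → (ℕ → ℤ) → Prop
  | exit {q σ} : A.nxt q (read P σ (A.test q)) = none → A.Run P q σ σ
  | step {q q' σ τ} : A.nxt q (read P σ (A.test q)) = some q' →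
      A.Run P q' (upd σ (A.act q')) τ → A.Run P q σ τ

/-- Started with the counters `σ`, the program halts with the counters `τ`. -/
def Exec (A : CounterProgram) (P : List BaseToken) (σ τ : ℕ → ℤ) : Prop :=
  A.Run P A.entry (upd σ (A.act A.entry)) τ

/-- Add `z` to the counter `k`. -/
def add (k : ℕ) (z : ℤ) : CounterProgram where
  Q := Unit
  entry := ()
  act _ := (k, z)
  test _ := 0
  nxt _ _ := none

/-- Sequential composition. -/
def seq (A B : CounterProgram) : CounterProgram where
  Q := A.Q ⊕ B.Q
  entry := Sum.inl A.entry
  act := Sum.elim A.act B.act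
  test := Sum.elim A.test B.test
  nxt
    | Sum.inl q, s => some <| match A.nxt q s with
      | some q' => Sum.inl q'
      | none => Sum.inr B.entry
    | Sum.inr q, s => (B.nxt q s).map Sum.inr

open Classical in
/-- As long as the symbol `s` read by the counter `k` satisfies `cont`, execute `B s`. -/
noncomputable def loop (k : ℕ) (cont : Option BaseToken → Bool)
    (B : Option BaseToken → CounterProgram) : CounterProgram where
  Q := Unit ⊕ Σ s, (B s).Q
  entry := Sum.inl ()
  act := Sum.elim (fun _ => (k, 0)) fun q => (B q.1).act q.2
  test := Sum.elim (fun _ => k) fun q => (B q.1).test q.2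
  nxt
    | Sum.inl _, s => if cont s then some (Sum.inr ⟨s, (B s).entry⟩) else none
    | Sum.inr ⟨r, q⟩, s => some <| match (B r).nxt q s with
      | some q' => Sum.inr ⟨r, q'⟩
      | none => Sum.inl ()

variable {P : List BaseToken}

theorem exec_add (k : ℕ) (z : ℤ) (σ : ℕ → ℤ) :
    (add k z).Exec P σ (Function.update σ k (σ k + z)) :=
  Run.exit rfl

theorem Run.seq_inr {A B : CounterProgram} {q : B.Q} {σ τ : ℕ → ℤ} (h : B.Run P q σ τ) :
    (seq A B).Run P (Sum.inr q) σ τ := by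
  induction h with
  | exit h => exact Run.exit (by simpa [seq] using h)
  | step h _ ih => exact Run.step (q' := Sum.inr _) (by simpa [seq] using h) ih

theorem Run.seq_inl {A B : CounterProgram} {q : A.Q} {σ τ ρ : ℕ → ℤ} (h : A.Run P q σ τ)
    (h' : B.Exec P τ ρ) : (seq A B).Run P (Sum.inl q) σ ρ := by
  induction h with
  | exit h => exact Run.step (q' := Sum.inr B.entry) (by simp [seq, h]) (Run.seq_inr h')
  | step h _ ih => exact Run.step (q' := Sum.inl _) (by simp [seq, h]) (ih h')

theorem Exec.congr {A : CounterProgram} {σ σ' τ τ' : ℕ → ℤ} (h : A.Exec P σ τ) (hσ : σ' = σ)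
    (hτ : τ' = τ) : A.Exec P σ' τ' := by
  rwa [hσ, hτ]

theorem Exec.seq {A B : CounterProgram} {σ τ ρ : ℕ → ℤ} (h : A.Exec P σ τ)
    (h' : B.Exec P τ ρ) : (seq A B).Exec P σ ρ :=
  Run.seq_inl h h'

section Loop

variable {k : ℕ} {cont : Option BaseToken → Bool} {B : Option BaseToken → CounterProgram}

theorem Run.loop_inr {s : Option BaseToken} {q : (B s).Q} {σ τ ρ : ℕ → ℤ}
    (h : (B s).Run P q σ τ) (h' : (loop k cont B).Run P (Sum.inl ()) τ ρ) :
    (loop k cont B).Run P (Sum.inr ⟨s, q⟩) σ ρ := by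
  induction h with
  | exit h =>
    refine Run.step (q' := Sum.inl ()) (by simp [loop, h]) ?_
    simpa [loop, upd] using h'
  | step h _ ih => exact Run.step (q' := Sum.inr ⟨s, _⟩) (by simp [loop, h]) (ih h')

theorem exec_loop_iff {σ τ : ℕ → ℤ} :
    (loop k cont B).Exec P σ τ ↔ (loop k cont B).Run P (Sum.inl ()) σ τ := by
  simp [Exec, loop, upd]

theorem exec_loop_exit {σ : ℕ → ℤ} (h : cont (read P σ k) = false) :
    (loop k cont B).Exec P σ σ :=
  exec_loop_iff.2 (Run.exit (by simp [loop, h]))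

theorem exec_loop_step {σ τ ρ : ℕ → ℤ} (h : cont (read P σ k) = true)
    (h₁ : (B (read P σ k)).Exec P σ τ) (h₂ : (loop k cont B).Exec P τ ρ) :
    (loop k cont B).Exec P σ ρ := by
  rw [exec_loop_iff] at h₂ ⊢
  exact Run.step (q' := Sum.inr ⟨read P σ k, (B (read P σ k)).entry⟩) (by simp [loop, h])
    (Run.loop_inr h₁ h₂)

/-- A loop that passes through the counters `st 0, …, st n` and stops there. -/
theorem exec_loop (st : ℕ → ℕ → ℤ) (n : ℕ) (hc : ∀ i < n, cont (read P (st i) k) = true)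
    (hB : ∀ i < n, (B (read P (st i) k)).Exec P (st i) (st (i + 1)))
    (hn : cont (read P (st n) k) = false) : (loop k cont B).Exec P (st 0) (st n) := by
  induction n generalizing st with
  | zero => exact exec_loop_exit hn
  | succ n ih =>
    exact exec_loop_step (hc 0 n.succ_pos) (hB 0 n.succ_pos)
      (ih (fun i => st (i + 1)) (fun i hi => hc _ (by omega)) (fun i hi => hB _ (by omega)) hn)

end Loop

/-- A list of base tokens that begins with its only start token. -/
def IsPrompt (P : List BaseToken) : Prop :=
  ∃ R, P = BaseToken.bos :: R ∧ BaseToken.bos ∉ R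

theorem IsPrompt.read_eq_bos (hP : IsPrompt P) (σ : ℕ → ℤ) (k : ℕ) :
    read P σ k = some BaseToken.bos ↔ σ k ≤ 0 := by
  obtain ⟨R, rfl, hR⟩ := hP
  rw [read, ← Int.toNat_eq_zero]
  cases (σ k).toNat with
  | zero => simp
  | succ n =>
    simp only [List.getElem?_cons_succ, Nat.succ_ne_zero, iff_false]
    exact fun h => hR (List.mem_of_getElem? h)

/-- As long as the counter `k` is positive, execute `B`. -/
noncomputable def whilePos (k : ℕ) (B : CounterProgram) : CounterProgram :=
  loop k (fun s => decide (s ≠ some BaseToken.bos)) fun _ => B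

theorem exec_whilePos (hP : IsPrompt P) {k : ℕ} {B : CounterProgram} (st : ℕ → ℕ → ℤ) (n : ℕ)
    (hc : ∀ i < n, 0 < st i k) (hB : ∀ i < n, B.Exec P (st i) (st (i + 1)))
    (hn : st n k ≤ 0) : (whilePos k B).Exec P (st 0) (st n) := by
  refine exec_loop st n (fun i hi => ?_) hB ?_
  · simpa [hP.read_eq_bos] using hc i hi
  · simpa [hP.read_eq_bos] using hn

/-- Set the counter `k` to zero. -/
noncomputable def clear (k : ℕ) : CounterProgram :=
  whilePos k (add k (-1))

theorem exec_clear (hP : IsPrompt P) (k : ℕ) (σ : ℕ → ℤ) (h : 0 ≤ σ k) :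
    (clear k).Exec P σ (Function.update σ k 0) := by
  obtain ⟨n, hn⟩ := Int.eq_ofNat_of_zero_le h
  have key := exec_whilePos (k := k) (B := add k (-1)) hP
    (fun i => Function.update σ k (n - i)) n (fun i hi => ?_) (fun i hi => ?_) ?_
  · refine key.congr ?_ ?_
    · rw [Nat.cast_zero, sub_zero, ← hn, Function.update_eq_self]
    · rw [sub_self]
  · simpa using hi
  · convert exec_add k (-1) _ using 1
    ext j
    simp only [Function.update_apply]
    split_ifs <;> grind
  · simp

/-- Add the counter `s` to the counters `d` and `e`, and set it to zero. -/
noncomputable def distribute (s d e : ℕ) : CounterProgram :=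
  whilePos s (seq (add s (-1)) (seq (add d 1) (add e 1)))

theorem exec_distribute (hP : IsPrompt P) {s d e : ℕ} (hsd : s ≠ d) (hse : s ≠ e) (hde : d ≠ e)
    (σ : ℕ → ℤ) (h : 0 ≤ σ s) :
    (distribute s d e).Exec P σ
      (Function.update (Function.update (Function.update σ s 0) d (σ d + σ s)) e
        (σ e + σ s)) := by
  obtain ⟨n, hn⟩ := Int.eq_ofNat_of_zero_le h
  have key := exec_whilePos (k := s) (B := seq (add s (-1)) (seq (add d 1) (add e 1))) hP
    (fun i => Function.update (Function.update (Function.update σ s (n - i)) d (σ d + i)) e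
      (σ e + i)) n (fun i hi => ?_) (fun i hi => ?_) ?_
  · refine key.congr ?_ ?_
    · ext j
      simp only [Function.update_apply]
      split_ifs <;> grind
    · rw [sub_self, hn]
  · simpa [hsd, hse] using hi
  · convert (exec_add s (-1) _).seq ((exec_add d 1 _).seq (exec_add e 1 _)) using 1
    ext j
    simp only [Function.update_apply]
    split_ifs <;> grind
  · simp [hsd, hse]

/-- Add the counter `s` to the counter `d`, and set it to zero. -/
noncomputable def move (s d : ℕ) : CounterProgram :=
  whilePos s (seq (add s (-1)) (add d 1))

theorem exec_move (hP : IsPrompt P) {s d : ℕ} (hsd : s ≠ d) (σ : ℕ → ℤ) (h : 0 ≤ σ s) :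
    (move s d).Exec P σ (Function.update (Function.update σ s 0) d (σ d + σ s)) := by
  obtain ⟨n, hn⟩ := Int.eq_ofNat_of_zero_le h
  have key := exec_whilePos (k := s) (B := seq (add s (-1)) (add d 1)) hP
    (fun i => Function.update (Function.update σ s (n - i)) d (σ d + i)) n
    (fun i hi => ?_) (fun i hi => ?_) ?_
  · refine key.congr ?_ ?_
    · ext j
      simp only [Function.update_apply]
      split_ifs <;> grind
    · rw [sub_self, hn]
  · simpa [hsd] using hi
  · convert (exec_add s (-1) _).seq (exec_add d 1 _) using 1
    ext j
    simp only [Function.update_apply]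
    split_ifs <;> grind
  · simp [hsd]

/-- Add the counter `s` to the counter `d`, preserving it with the help of the counter `e`. -/
noncomputable def copy (s d e : ℕ) : CounterProgram :=
  seq (distribute s d e) (move e s)

theorem exec_copy (hP : IsPrompt P) {s d e : ℕ} (hsd : s ≠ d) (hse : s ≠ e) (hde : d ≠ e)
    (σ : ℕ → ℤ) (h : 0 ≤ σ s) (he : σ e = 0) :
    (copy s d e).Exec P σ (Function.update σ d (σ d + σ s)) := by
  have key := (exec_distribute hP hsd hse hde σ h).seq
    (exec_move hP hse.symm _ (by simp [he, h]))
  refine key.congr rfl ?_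
  ext j
  simp only [Function.update_apply]
  split_ifs <;> grind

/-! ### Primitive recursive functions by counter programs -/

/-- The function `f` is computed by counter programs: whatever the counters of the arguments and of
the result (initially zero), there is a program that writes the value of `f` into the latter and
leaves all other counters unchanged at the end. It may use the counters from `a` on, which
have to be zero, as its memory. -/
def IsCounterComputable {n : ℕ} (f : List.Vector ℕ n → ℕ) : Prop :=
  ∀ (inp : Fin n → ℕ) (out a : ℕ), (∀ i, inp i < a) → out < a → (∀ i, inp i ≠ out) →
    ∃ A : CounterProgram, ∀ P, IsPrompt P → ∀ σ : ℕ → ℤ, (∀ k, a ≤ k → σ k = 0) → σ out = 0 →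
      ∀ v : List.Vector ℕ n, (∀ i, σ (inp i) = v.get i) →
        A.Exec P σ (Function.update σ out (f v))

theorem isCounterComputable_zero : IsCounterComputable (n := 0) fun _ => 0 := by
  intro inp out a _ _ _
  refine ⟨add out 0, fun P _ σ _ hout v _ => ?_⟩
  convert exec_add out 0 σ using 1
  simp [hout]

theorem isCounterComputable_get {n : ℕ} (i : Fin n) :
    IsCounterComputable fun v : List.Vector ℕ n => v.get i := by
  intro inp out a hinp hout hne
  refine ⟨copy (inp i) out a, fun P hP σ ha h0 v hv => ?_⟩
  convert exec_copy hP (hne i) (hinp i).ne hout.ne σ (by simp [hv]) (ha a le_rfl) using 1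
  simp [h0, hv]

theorem isCounterComputable_succ :
    IsCounterComputable fun v : List.Vector ℕ 1 => v.head.succ := by
  intro inp out a hinp hout hne
  obtain ⟨A, hA⟩ := isCounterComputable_get (0 : Fin 1) inp out a hinp hout hne
  refine ⟨seq A (add out 1), fun P hP σ ha h0 v hv => ?_⟩
  convert (hA P hP σ ha h0 v hv).seq (exec_add out 1 _) using 1
  simp

/-- Compute the values of `g` one after another into the counters `a, a + 1, …`. -/
theorem exists_exec_family {m n : ℕ} {g : Fin n → List.Vector ℕ m → ℕ}
    (hg : ∀ i, IsCounterComputable (g i)) (inp : Fin m → ℕ) (a : ℕ) (hinp : ∀ i, inp i < a)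
    (l : List (Fin n)) (hl : l.Nodup) :
    ∃ A : CounterProgram, ∀ P, IsPrompt P → ∀ σ : ℕ → ℤ, (∀ k, a ≤ k → σ k = 0) →
      ∀ v : List.Vector ℕ m, (∀ i, σ (inp i) = v.get i) → ∃ τ, A.Exec P σ τ ∧
        (∀ k, (∀ i ∈ l, k ≠ a + i) → τ k = σ k) ∧ ∀ i ∈ l, τ (a + i) = g i v := by
  induction l with
  | nil =>
    refine ⟨add 0 0, fun P _ σ _ v _ => ⟨σ, ?_, by simp, by simp⟩⟩
    convert exec_add 0 0 σ using 1
    simp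
  | cons i l ih =>
    obtain ⟨hi, hl⟩ := List.nodup_cons.1 hl
    obtain ⟨A, hA⟩ := ih hl
    obtain ⟨B, hB⟩ := hg i inp (a + i) (a + n) (fun j => by have := hinp j; omega)
      (by omega) (fun j => by have := hinp j; omega)
    refine ⟨seq A B, fun P hP σ ha v hv => ?_⟩
    obtain ⟨τ, hτ, hτ₁, hτ₂⟩ := hA P hP σ ha v hv
    have hfresh : ∀ j ∈ l, a + (i : ℕ) ≠ a + (j : ℕ) := by
      intro j hj h
      exact hi (by rwa [show i = j from Fin.ext (by omega)])
    refine ⟨_, hτ.seq (hB P hP τ (fun k hk => ?_) ?_ v fun j => ?_), fun k hk => ?_, ?_⟩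
    · rw [hτ₁ k fun j _ => by omega, ha k (by omega)]
    · rw [hτ₁ _ hfresh, ha _ (by omega)]
    · rw [hτ₁ _ fun j' _ => by have := hinp j; omega, hv]
    · rw [Function.update_of_ne (hk i (by simp)), hτ₁ k fun j hj => hk j (by simp [hj])]
    · intro j hj
      rcases List.mem_cons.1 hj with rfl | hj
      · simp
      · rw [Function.update_of_ne (hfresh j hj).symm, hτ₂ j hj]

/-- Clear the counters from `a` to `a + n - 1`. -/
theorem exists_exec_clear (a n : ℕ) :
    ∃ A : CounterProgram, ∀ P, IsPrompt P → ∀ σ : ℕ → ℤ, (∀ k, a ≤ k → 0 ≤ σ k) →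
      A.Exec P σ fun k => if a ≤ k ∧ k < a + n then 0 else σ k := by
  induction n with
  | zero =>
    refine ⟨add 0 0, fun P _ σ _ => ?_⟩
    convert exec_add 0 0 σ using 1
    ext k
    rw [if_neg (by omega)]
    simp
  | succ n ih =>
    obtain ⟨A, hA⟩ := ih
    refine ⟨seq A (clear (a + n)), fun P hP σ h => ?_⟩
    convert (hA P hP σ h).seq (exec_clear hP (a + n) _ ?_) using 1
    · ext k
      simp only [Function.update_apply]
      split_ifs <;> first | rfl | omega
    · simp [h]

theorem IsCounterComputable.comp {m n : ℕ} {f : List.Vector ℕ n → ℕ}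
    {g : Fin n → List.Vector ℕ m → ℕ} (hf : IsCounterComputable f)
    (hg : ∀ i, IsCounterComputable (g i)) :
    IsCounterComputable fun v => f (List.Vector.ofFn fun i => g i v) := by
  intro inp out a hinp hout hne
  obtain ⟨A, hA⟩ := exists_exec_family hg inp a hinp (List.finRange n) (List.nodup_finRange n)
  obtain ⟨B, hB⟩ := hf (fun i => a + i) out (a + n) (fun i => by omega) (by omega)
    (fun i => by omega)
  obtain ⟨C, hC⟩ := exists_exec_clear a n
  refine ⟨seq A (seq B C), fun P hP σ ha h0 v hv => ?_⟩
  obtain ⟨τ, hτ, hτ₁, hτ₂⟩ := hA P hP σ ha v hv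
  have hlow : ∀ k, k < a ∨ a + n ≤ k → τ k = σ k := fun k hk => hτ₁ k fun i _ => by omega
  have hmid : ∀ k, a ≤ k → 0 ≤ τ k := by
    intro k hk
    by_cases h : k < a + n
    · have := hτ₂ ⟨k - a, by omega⟩ (List.mem_finRange _)
      simp only [Nat.add_sub_cancel' hk] at this
      rw [this]
      exact Int.natCast_nonneg _
    · rw [hlow k (by omega), ha k hk]
  convert hτ.seq ((hB P hP τ (fun k hk => ?_) ?_ (List.Vector.ofFn fun i => g i v)
    fun i => ?_).seq (hC P hP _ fun k hk => ?_)) using 1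
  · ext k
    simp only [Function.update_apply]
    split_ifs with h1 h2 h2
    · omega
    · rfl
    · exact ha k h2.1
    · exact (hlow k (by omega)).symm
  · rw [hlow k (by omega), ha k (by omega)]
  · rw [hlow _ (by omega), h0]
  · rw [hτ₂ i (List.mem_finRange i), List.Vector.get_ofFn]
  · rw [Function.update_of_ne (by omega)]
    exact hmid k hk

theorem IsCounterComputable.prec {n : ℕ} {f : List.Vector ℕ n → ℕ}
    {g : List.Vector ℕ (n + 2) → ℕ} (hf : IsCounterComputable f) (hg : IsCounterComputable g) :
    IsCounterComputable fun v : List.Vector ℕ (n + 1) =>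
      v.head.rec (f v.tail) fun y IH => g (y ::ᵥ IH ::ᵥ v.tail) := by
  intro inp out a hinp hout hne
  -- the counters `a`, `a + 1`, `a + 2`, `a + 3` hold the index, the value at the index, the value
  -- at the next index, and the number of steps left
  obtain ⟨A, hA⟩ := hf (fun i => inp i.succ) (a + 1) (a + 4)
    (fun i => by have := hinp i.succ; omega) (by omega) (fun i => by have := hinp i.succ; omega)
  obtain ⟨B, hB⟩ := hg (Fin.cons a (Fin.cons (a + 1) fun i => inp i.succ)) (a + 2) (a + 4)
    (fun i => by
      refine Fin.cases ?_ (fun i => Fin.cases ?_ (fun i => ?_) i) i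
      · simp
      · simp
      · have := hinp i.succ; simp only [Fin.cons_succ]; omega)
    (by omega)
    (fun i => by
      refine Fin.cases ?_ (fun i => Fin.cases ?_ (fun i => ?_) i) i
      · simp
      · simp
      · have := hinp i.succ; simp only [Fin.cons_succ]; omega)
  refine ⟨seq A (seq (copy (inp 0) (a + 3) (a + 4))
    (seq (whilePos (a + 3) (seq B (seq (clear (a + 1)) (seq (move (a + 2) (a + 1))
      (seq (add a 1) (add (a + 3) (-1)))))))
    (seq (move (a + 1) out) (clear a)))), fun P hP σ ha h0 v hv => ?_⟩
  have htail : ∀ i : Fin n, v.get i.succ = v.tail.get i := fun i =>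
    (List.Vector.get_tail_succ v i).symm
  set r : ℕ → ℕ := fun y => Nat.rec (f v.tail) (fun y IH => g (y ::ᵥ IH ::ᵥ v.tail)) y
  have hhead : σ (inp 0) = v.head := by rw [hv, List.Vector.get_zero]
  have h1 := hA P hP σ (fun k hk => ha k (by omega)) (ha _ (by omega)) v.tail
    (fun i => by rw [hv, htail])
  set st : ℕ → ℕ → ℤ := fun i => Function.update (Function.update (Function.update σ a i) (a + 1)
    (r i)) (a + 3) (v.head - i) with hst
  have h2 := exec_whilePos (k := a + 3) (B := seq B (seq (clear (a + 1))
      (seq (move (a + 2) (a + 1)) (seq (add a 1) (add (a + 3) (-1)))))) hP st v.head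
      (fun i hi => by simpa [hst] using hi) (fun i hi => ?_) (by simp [hst])
  · refine h1.seq ((exec_copy hP (by have := hinp 0; omega) (by have := hinp 0; omega) (by omega) _
      ?_ ?_).seq (Exec.seq (τ := st v.head) ?_ ?_))
    · rw [Function.update_of_ne (by have := hinp 0; omega), hhead]
      exact Int.natCast_nonneg _
    · rw [Function.update_of_ne (by omega), ha _ (by omega)]
    · convert h2 using 1
      ext k
      have e0 := ha a le_rfl
      have e3 := ha (a + 3) (by omega)
      have := hinp 0
      have hr0 : r 0 = f v.tail := rfl
      simp only [hst, Function.update_apply, hr0]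
      grind
    · convert (exec_move hP (s := a + 1) (d := out) (by omega) _ ?_).seq (exec_clear hP a _ ?_)
        using 1
      · ext k
        have e0 := ha a le_rfl
        have e1 := ha (a + 1) (by omega)
        have e3 := ha (a + 3) (by omega)
        simp only [hst, Function.update_apply]
        grind
      · simp [hst]
      · have : a ≠ out := by omega
        simp [hst, this]
  · refine (hB P hP (st i) (fun k hk => ?_) ?_ (i ::ᵥ r i ::ᵥ v.tail) fun j => ?_).seq
      (Exec.seq (exec_clear hP _ _ ?_) ?_)
    · simp only [hst, Function.update_apply]
      rw [if_neg (by omega), if_neg (by omega), if_neg (by omega), ha k (by omega)]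
    · simp [hst, ha]
    · refine Fin.cases ?_ (fun j => Fin.cases ?_ (fun j => ?_) j) j
      · simp [hst]
      · rw [List.Vector.get_cons_succ, List.Vector.get_cons_zero]
        simp [hst]
      · have := hinp j.succ
        simp only [Fin.cons_succ, List.Vector.get_cons_succ, hst, Function.update_apply]
        rw [if_neg (by omega), if_neg (by omega), if_neg (by omega), hv, htail]
    · simp [hst]
    · convert (exec_move hP (s := a + 2) (d := a + 1) (by omega) _ ?_).seq
        ((exec_add a 1 _).seq (exec_add (a + 3) (-1) _)) using 1
      · ext k
        have e2 := ha (a + 2) (by omega)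
        have hrs : r (i + 1) = g (i ::ᵥ r i ::ᵥ v.tail) := rfl
        simp only [hst, Function.update_apply, hrs]
        grind
      · simp

/-- Every primitive recursive function is computed by counter programs. -/
theorem isCounterComputable_of_primrec {n : ℕ} {f : List.Vector ℕ n → ℕ} (hf : Nat.Primrec' f) :
    IsCounterComputable f := by
  induction hf with
  | zero => exact isCounterComputable_zero
  | succ => exact isCounterComputable_succ
  | get i => exact isCounterComputable_get i
  | comp g _ _ ihf ihg => exact ihf.comp ihg
  | prec _ _ ihf ihg => exact ihf.prec ihg

end CounterProgram

/-! ### Reading the prompt -/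

namespace CounterProgram

/-- Read the prompt from left to right, updating a number by functions `g s` that depend on
the symbols `s`, and then apply `F`; the result is in the counter `3`. -/
theorem exists_exec_foldl {g : Option BaseToken → ℕ → ℕ} {F : ℕ → ℕ} (hg : ∀ s, Primrec (g s))
    (hF : Primrec F) : ∃ A : CounterProgram, ∀ R, BaseToken.bos ∉ R →
      ∃ τ, A.Exec (BaseToken.bos :: R) 0 τ ∧ τ 3 = F (R.foldl (fun n t => g (some t) n) 0) := by
  have comp : ∀ {f : ℕ → ℕ}, Primrec f → ∀ out : ℕ, 1 < out → out < 4 →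
      ∃ A : CounterProgram, ∀ P, IsPrompt P → ∀ σ : ℕ → ℤ, (∀ k, 4 ≤ k → σ k = 0) → σ out = 0 →
        ∀ n : ℕ, σ 1 = n → A.Exec P σ (Function.update σ out (f n)) := by
    intro f hf out h1 h4
    obtain ⟨A, hA⟩ := isCounterComputable_of_primrec (Nat.Primrec'.prim_iff₁.2 hf) (fun _ => 1)
      out 4 (fun _ => by norm_num) h4 (fun _ => h1.ne)
    exact ⟨A, fun P hP σ hσ h0 n hn => hA P hP σ hσ h0 (n ::ᵥ List.Vector.nil)
      fun i => by simp [hn, Subsingleton.elim i 0]⟩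
  choose A hA using fun s => comp (hg s) 2 (by norm_num) (by norm_num)
  obtain ⟨B, hB⟩ := comp hF 3 (by norm_num) (by norm_num)
  -- the counter `0` is the position in the prompt, the counter `1` holds the number, and the
  -- counter `2` the next number
  refine ⟨seq (add 0 1) (seq (loop 0 Option.isSome
    fun s => seq (A s) (seq (clear 1) (seq (move 2 1) (add 0 1)))) B), fun R hR => ?_⟩
  have hP : IsPrompt (BaseToken.bos :: R) := ⟨R, rfl, hR⟩
  set N : ℕ → ℕ := fun i => (R.take i).foldl (fun n t => g (some t) n) 0 with hN
  set st : ℕ → ℕ → ℤ := fun i =>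
    Function.update (Function.update 0 0 ((i : ℤ) + 1)) 1 (N i) with hst
  have hread : ∀ i, read (BaseToken.bos :: R) (st i) 0 = R[i]? := by
    intro i
    have : ((i : ℤ) + 1).toNat = i + 1 := by omega
    simp [read, hst, this]
  have hloop := exec_loop (P := BaseToken.bos :: R) (k := 0) (cont := Option.isSome)
    (B := fun s => seq (A s) (seq (clear 1) (seq (move 2 1) (add 0 1)))) st R.length
    (fun i hi => by simp [hread, hi]) (fun i hi => ?_) (by simp [hread])
  · refine ⟨_, (exec_add 0 1 0).seq ((hloop.congr ?_ rfl).seq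
      (hB _ hP _ (fun k hk => ?_) ?_ (N R.length) ?_)), ?_⟩
    · ext k
      simp only [hst, hN, Function.update_apply]
      split_ifs <;> simp_all
    · simp only [hst, Function.update_apply]
      rw [if_neg (by omega), if_neg (by omega), Pi.zero_apply]
    · simp [hst]
    · simp [hst]
    · simp [hN]
  · refine (hA _ _ hP _ (fun k hk => ?_) ?_ (N i) ?_).seq ((exec_clear hP 1 _ ?_).seq
      (((exec_move hP (by norm_num) _ ?_).seq (exec_add 0 1 _)).congr rfl ?_))
    · simp only [hst, Function.update_apply]
      rw [if_neg (by omega), if_neg (by omega), Pi.zero_apply]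
    · simp [hst]
    · simp [hst]
    · simp [hst]
    · simp
    · have hs : N (i + 1) = g (R[i]?) (N i) := by
        simp only [hN]
        rw [List.take_add_one, List.foldl_append, List.getElem?_eq_getElem hi]
        rfl
      ext k
      simp only [hst, Function.update_apply, Pi.zero_apply]
      rw [hread, hs]
      grind

end CounterProgram

/-! ### Writing numbers in binary -/

/-- Tokens for the conversion of a counter `m` to binary. The numbers `0, 1, …, m` are written down
one after another, each as a block of digits (least significant digit first) that follows a
delimiter, by copying the preceding block and adding `1`. -/
inductive BlockToken
  /-- the delimiter before the (empty) block of the number `0` -/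
  | zero
  /-- the delimiter before the successor of the preceding number; decreases the counter -/
  | dec
  /-- the digit `1` that makes a block longer than the preceding block -/
  | grow
  /-- a digit, together with the carry to the next digit -/
  | digit (b carry : Bool)
  deriving DecidableEq, Fintype

/-- The carry to the next digit. -/
def BlockToken.carry : BlockToken → Bool
  | zero => false
  | dec => true
  | grow => false
  | digit _ c => c

/-- The digits of the number `n + 1`, if `c` is true, and `n` otherwise, from the digits of `n`. -/
def addCarry : Bool → List Bool → List Bool
  | c, [] => if c then [true] else []
  | c, b :: l => (b ^^ c) :: addCarry (b && c) l

/-- The tokens of a block that is written below digits to which the carry `c` is added. -/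
def blockTokens : Bool → List Bool → List BlockToken
  | c, [] => if c then [BlockToken.grow] else []
  | c, b :: l => BlockToken.digit (b ^^ c) (b && c) :: blockTokens (b && c) l

theorem addCarry_false (l : List Bool) : addCarry false l = l := by
  induction l with
  | nil => rfl
  | cons b l ih => simp [addCarry, ih]

theorem addCarry_true_bits (n : ℕ) : addCarry true (Nat.bits n) = Nat.bits (n + 1) := by
  induction n using Nat.binaryRec' with
  | zero => simp [addCarry]
  | bit b n hb ih =>
    rw [Nat.bits_append_bit _ _ hb, addCarry]
    cases b with
    | false =>
      rw [Bool.false_and, addCarry_false,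
        show Nat.bit false n + 1 = Nat.bit true n by simp [Nat.bit_val],
        Nat.bits_append_bit n true (by simp)]
      rfl
    | true =>
      rw [Bool.true_and, ih,
        show Nat.bit true n + 1 = Nat.bit false (n + 1) by simp [Nat.bit_val]; ring,
        Nat.bits_append_bit (n + 1) false (by simp)]
      rfl

namespace CounterProgram

/-! ### The machine that executes a counter program -/

/-- The vocabulary of the machine that executes a counter program: the scratch tokens are the
states of the program, and the tokens for the conversion of the result to binary. -/
abbrev Token (A : CounterProgram) : Type := BaseToken ⊕ (A.Q ⊕ BlockToken)

/-- The binary digit of a block that a token stands for. -/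
def value (A : CounterProgram) : A.Token → Option Bool
  | Sum.inr (Sum.inr BlockToken.grow) => some true
  | Sum.inr (Sum.inr (BlockToken.digit b _)) => some b
  | _ => none

/-- The change of the counter `k` by a token. -/
def counterWeight (A : CounterProgram) (k : ℕ) : A.Token → ℤ
  | Sum.inr (Sum.inl q) => if k = (A.act q).1 then (A.act q).2 else 0
  | Sum.inr (Sum.inr BlockToken.dec) => -1
  | _ => 0

/-- The change of the pointer that is used to copy a block. It stays behind the end of the sequence
by the length of a block, and all tokens move it by `1`, except those by which blocks grow. (The
start token does not move it either, since positions are zero-based.) -/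
def copyWeight (A : CounterProgram) : A.Token → ℤ
  | Sum.inl BaseToken.bos => 0
  | Sum.inr (Sum.inr BlockToken.grow) => 0
  | _ => 1

open Classical in
/-- The token after a token of a block. Here `src` is the token copied, and `z` is the token that
the counter `c` points to, which is the start token if the counter is zero. -/
noncomputable def nextBlock (A : CounterProgram) (carry : Bool) (src z : A.Token) : A.Token :=
  match A.value src with
  | some b => Sum.inr (Sum.inr (BlockToken.digit (b ^^ carry) (b && carry)))
  | none => if carry then Sum.inr (Sum.inr BlockToken.grow)
      else if z = Sum.inl BaseToken.bos then Sum.inl BaseToken.ans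
      else Sum.inr (Sum.inr BlockToken.dec)

/-- The token after the answer token or an output digit, where `src` is the token copied. -/
def nextOutput (A : CounterProgram) (src : A.Token) : A.Token :=
  match A.value src with
  | some b => Sum.inl (BaseToken.bit b)
  | none => Sum.inl BaseToken.eos

/-- The machine that executes the program `A` and outputs the counter `c`. For each state `q`,
one of its pointers is the counter tested by `q`; of the remaining pointers, `Sum.inr false` is the
counter `c` and `Sum.inr true` is used to copy blocks. -/
noncomputable abbrev toMachine (A : CounterProgram) (c : ℕ) : PointerMachine where
  S := A.Q ⊕ BlockToken
  κ := A.Q ⊕ Bool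
  weight
    | Sum.inl q => A.counterWeight (A.test q)
    | Sum.inr false => A.counterWeight c
    | Sum.inr true => A.copyWeight
  next t f := match t with
    | Sum.inr (Sum.inl q) => match A.nxt q (f (Sum.inl q)).getLeft? with
      | some q' => Sum.inr (Sum.inl q')
      | none => Sum.inr (Sum.inr BlockToken.zero)
    | Sum.inr (Sum.inr s) => A.nextBlock s.carry (f (Sum.inr true)) (f (Sum.inr false))
    | Sum.inl BaseToken.bos => Sum.inr (Sum.inl A.entry)
    | Sum.inl BaseToken.sep => Sum.inr (Sum.inl A.entry)
    | Sum.inl _ => A.nextOutput (f (Sum.inr true))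

variable {A : CounterProgram} {c : ℕ}

theorem step_append (w : List A.Token) (t : A.Token) :
    (A.toMachine c).step (w ++ [t]) = (A.toMachine c).next t ((A.toMachine c).look (w ++ [t])) := by
  simp [PointerMachine.step]

theorem look_eq {w : List A.Token} {k : A.Q ⊕ Bool} {n : ℕ} {t : A.Token}
    (h : (A.toMachine c).pointer w k = n) (ht : w[n]? = some t) :
    (A.toMachine c).look w k = t := by
  obtain ⟨hn, rfl⟩ := List.getElem?_eq_some_iff.1 ht
  have : (A.toMachine c).target w k = n := by
    rw [PointerMachine.target, h, Int.toNat_natCast]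
    omega
  rw [PointerMachine.look, this, List.getD_eq_getElem?_getD, ht, Option.getD_some]

theorem look_eq_bos_iff {w : List A.Token} (hw : Sum.inl BaseToken.bos ∉ w) (hne : w ≠ [])
    (k : A.Q ⊕ Bool) :
    (A.toMachine c).look (Sum.inl BaseToken.bos :: w) k = Sum.inl BaseToken.bos ↔
      (A.toMachine c).pointer (Sum.inl BaseToken.bos :: w) k ≤ 0 := by
  have hlen := List.length_pos_iff.2 hne
  rw [PointerMachine.look, PointerMachine.target, ← Int.toNat_eq_zero]
  set n := ((A.toMachine c).pointer (Sum.inl BaseToken.bos :: w) k).toNat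
  obtain h | ⟨j, hj⟩ : n = 0 ∨ ∃ j, min n ((Sum.inl BaseToken.bos :: w).length - 1) = j + 1 :=
    (Nat.eq_zero_or_pos n).imp_right fun h =>
      ⟨min n w.length - 1, by simp only [List.length_cons, Nat.add_sub_cancel]; omega⟩
  · simp [h]
  · have hjl : j < w.length := by
      simp only [List.length_cons, Nat.add_sub_cancel] at hj
      omega
    have hn : n ≠ 0 := by omega
    rw [hj]
    simp only [List.getD_cons_succ, hn, iff_false]
    rw [List.getD_eq_getElem _ _ hjl]
    exact fun h => hw (h ▸ List.getElem_mem hjl)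

/-- In the course of the program, the tokens that its states point to are those they read. -/
theorem getLeft?_look {P : List BaseToken} {qs : List A.Q} (hqs : qs ≠ []) {w : List A.Token}
    (hw : w = P.map Sum.inl ++ qs.map fun q => Sum.inr (Sum.inl q)) {σ : ℕ → ℤ}
    (hσ : ∀ k, (w.map (A.counterWeight k)).sum = σ k) (q : A.Q) :
    ((A.toMachine c).look w (Sum.inl q)).getLeft? = read P σ (A.test q) := by
  have hlen : w.length = P.length + qs.length := by simp [hw]
  have hpos := List.length_pos_iff.2 hqs
  have hp : (A.toMachine c).pointer w (Sum.inl q) = σ (A.test q) := hσ _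
  rw [PointerMachine.look, PointerMachine.target, read, hp]
  set n := (σ (A.test q)).toNat
  rcases lt_or_ge n P.length with h | h
  · rw [min_eq_left (by omega), List.getD_eq_getElem _ _ (by omega : n < w.length)]
    simp only [hw]
    rw [List.getElem_append_left (by simpa using h)]
    simp [h]
  · rw [List.getD_eq_getElem _ _ (by omega : min n (w.length - 1) < w.length)]
    simp only [hw]
    rw [List.getElem_append_right (by simp; omega)]
    simp [h]

theorem step_state {w v : List A.Token} {q : A.Q} (hw : w = v ++ [Sum.inr (Sum.inl q)])
    {o : Option A.Q} (h : A.nxt q ((A.toMachine c).look w (Sum.inl q)).getLeft? = o) :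
    (A.toMachine c).step w =
      o.elim (Sum.inr (Sum.inr BlockToken.zero)) fun q' => Sum.inr (Sum.inl q') := by
  subst hw
  rw [step_append, ← h]
  change (match A.nxt q ((A.toMachine c).look _ (Sum.inl q)).getLeft? with
    | some q' => Sum.inr (Sum.inl q')
    | none => Sum.inr (Sum.inr BlockToken.zero)) = _
  cases A.nxt q ((A.toMachine c).look (v ++ [Sum.inr (Sum.inl q)]) (Sum.inl q)).getLeft? <;> rfl

/-- The machine goes through the states of the program, until the delimiter `BlockToken.zero`
indicates that the program has halted. -/
theorem generates_run {P : List BaseToken} {q : A.Q} {σ τ : ℕ → ℤ} (h : A.Run P q σ τ)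
    (qs : List A.Q) (w : List A.Token)
    (hw : w = P.map Sum.inl ++ (qs ++ [q]).map fun q => Sum.inr (Sum.inl q))
    (hσ : ∀ k, (w.map (A.counterWeight k)).sum = σ k) :
    ∃ us : List A.Q, (A.toMachine c).Generates w
        ((us.map fun q => Sum.inr (Sum.inl q)) ++ [Sum.inr (Sum.inr BlockToken.zero)]) ∧
      ∀ k, ((w ++ us.map fun q => Sum.inr (Sum.inl q)).map (A.counterWeight k)).sum = τ k := by
  induction h generalizing qs w with
  | @exit q σ hq =>
    refine ⟨[], ⟨?_, trivial⟩, by simpa using hσ⟩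
    have := getLeft?_look (c := c) (by simp) hw hσ q
    rw [← this] at hq
    exact step_state (by rw [hw, List.map_append, ← List.append_assoc]; rfl) hq
  | @step q q' σ τ hq _ ih =>
    have := getLeft?_look (c := c) (by simp) hw hσ q
    obtain ⟨us, hus, hτ⟩ := ih (qs ++ [q]) (w ++ [Sum.inr (Sum.inl q')]) (by simp [hw]) (by
      intro k
      simp only [List.map_append, List.sum_append, hσ, upd, Function.update_apply]
      simp only [List.map_cons, List.map_nil, List.sum_singleton, counterWeight]
      split_ifs with hk
      · rw [hk]
      · simp)
    refine ⟨q' :: us, ⟨?_, hus⟩, by simpa using hτ⟩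
    rw [← this] at hq
    exact step_state (by rw [hw, List.map_append, ← List.append_assoc]; rfl) hq

theorem pointer_append (w u : List A.Token) (k : A.Q ⊕ Bool) :
    (A.toMachine c).pointer (w ++ u) k =
      (A.toMachine c).pointer w k + (A.toMachine c).pointer u k := by
  simp [PointerMachine.pointer]

/-- From the answer token on, the digits that the copying pointer runs through are output. -/
theorem generates_output (l : List Bool) (w : List A.Token) (t : BaseToken) (p : ℕ)
    (ht : t = BaseToken.ans ∨ ∃ b, t = BaseToken.bit b)
    (hp : (A.toMachine c).pointer (w ++ [Sum.inl t]) (Sum.inr true) = p)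
    (hl : ∀ i ≤ l.length, ∃ s, (w ++ [Sum.inl t])[p + i]? = some s ∧ A.value s = l[i]?) :
    (A.toMachine c).Generates (w ++ [Sum.inl t])
      ((l.map fun b => Sum.inl (BaseToken.bit b)) ++ [Sum.inl BaseToken.eos]) := by
  have hstep : ∀ s, (w ++ [Sum.inl t])[p]? = some s →
      (A.toMachine c).step (w ++ [Sum.inl t]) = A.nextOutput s := by
    intro s hs
    rw [step_append, ← look_eq hp hs]
    rcases ht with rfl | ⟨b, rfl⟩ <;> rfl
  obtain ⟨s, hs, hv⟩ := hl 0 (Nat.zero_le _)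
  replace hstep := hstep s hs
  clear hs
  induction l generalizing w t p s with
  | nil => exact ⟨by rw [hstep, nextOutput, hv]; rfl, trivial⟩
  | cons b l ih =>
    refine ⟨by rw [hstep, nextOutput, hv]; rfl, ?_⟩
    have hp' : (A.toMachine c).pointer ((w ++ [Sum.inl t]) ++ [Sum.inl (BaseToken.bit b)])
        (Sum.inr true) = (p + 1 : ℕ) := by
      rw [pointer_append, hp]
      simp [PointerMachine.pointer, copyWeight]
    have hl' : ∀ i ≤ l.length, ∃ s,
        ((w ++ [Sum.inl t]) ++ [Sum.inl (BaseToken.bit b)])[p + 1 + i]? = some s ∧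
          A.value s = l[i]? := by
      intro i hi
      obtain ⟨s, hs, hv⟩ := hl (i + 1) (by simpa using hi)
      refine ⟨s, ?_, by simpa using hv⟩
      rw [show p + 1 + i = p + (i + 1) by ring,
        List.getElem?_append_left (List.getElem?_eq_some_iff.1 hs).1, hs]
    obtain ⟨s', hs', hv'⟩ := hl' 0 (Nat.zero_le _)
    refine ih _ _ _ (Or.inr ⟨b, rfl⟩) hp' hl' s' hv' ?_
    rw [step_append, ← look_eq hp' hs']

/-- In a block, the digits that the copying pointer runs through are copied, with the carry
added. -/
theorem generates_block (l : List Bool) (w : List A.Token) (b₀ : BlockToken) (p : ℕ)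
    (hp : (A.toMachine c).pointer (w ++ [Sum.inr (Sum.inr b₀)]) (Sum.inr true) = p)
    (hl : ∀ i ≤ l.length, ∃ s, (w ++ [Sum.inr (Sum.inr b₀)])[p + i]? = some s ∧
      A.value s = l[i]?) :
    (A.toMachine c).Generates (w ++ [Sum.inr (Sum.inr b₀)])
      ((blockTokens b₀.carry l).map fun b => Sum.inr (Sum.inr b)) := by
  induction l generalizing w b₀ p with
  | nil =>
    obtain ⟨s, hs, hv⟩ := hl 0 (Nat.zero_le _)
    rw [blockTokens]
    cases hc : b₀.carry with
    | false => exact trivial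
    | true =>
      refine ⟨?_, trivial⟩
      rw [step_append]
      change A.nextBlock b₀.carry _ _ = _
      rw [look_eq hp hs, nextBlock, hv, hc]
      rfl
  | cons b l ih =>
    obtain ⟨s, hs, hv⟩ := hl 0 (Nat.zero_le _)
    refine ⟨?_, ih _ (BlockToken.digit (b ^^ b₀.carry) (b && b₀.carry)) (p + 1) ?_ ?_⟩
    · rw [step_append]
      change A.nextBlock b₀.carry _ _ = _
      rw [look_eq hp hs, nextBlock, hv]
      rfl
    · rw [pointer_append, hp]
      simp [PointerMachine.pointer, copyWeight]
    · intro i hi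
      obtain ⟨s, hs, hv⟩ := hl (i + 1) (by simpa using hi)
      refine ⟨s, ?_, by simpa using hv⟩
      rw [show p + 1 + i = p + (i + 1) by ring,
        List.getElem?_append_left (List.getElem?_eq_some_iff.1 hs).1, hs]

theorem map_value_blockTokens (carry : Bool) (l : List Bool) :
    (blockTokens carry l).map (fun b => A.value (Sum.inr (Sum.inr b))) =
      (addCarry carry l).map some := by
  induction l generalizing carry with
  | nil => cases carry <;> rfl
  | cons b l ih =>
    rw [blockTokens, addCarry, List.map_cons, List.map_cons, ih]
    rfl

theorem sum_copyWeight_blockTokens (carry : Bool) (l : List Bool) :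
    ((blockTokens carry l).map fun b => A.copyWeight (Sum.inr (Sum.inr b))).sum = l.length := by
  induction l generalizing carry with
  | nil => cases carry <;> rfl
  | cons b l ih =>
    rw [blockTokens, List.map_cons, List.sum_cons, ih, List.length_cons, Nat.cast_succ, add_comm]
    rfl

theorem sum_counterWeight_blockTokens (carry : Bool) (l : List Bool) (k : ℕ) :
    ((blockTokens carry l).map fun b => A.counterWeight k (Sum.inr (Sum.inr b))).sum = 0 := by
  induction l generalizing carry with
  | nil => cases carry <;> rfl
  | cons b l ih =>
    rw [blockTokens, List.map_cons, List.sum_cons, ih]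
    rfl

theorem carry_getLast_blockTokens (b₀ : BlockToken) (l : List Bool) :
    (((b₀ :: blockTokens b₀.carry l).getLast (List.cons_ne_nil _ _)).carry) = false := by
  induction l generalizing b₀ with
  | nil =>
    cases h : b₀.carry with
    | false => exact h
    | true => rfl
  | cons b l ih =>
    simp only [blockTokens]
    rw [List.getLast_cons (by simp)]
    exact ih (BlockToken.digit (b ^^ b₀.carry) (b && b₀.carry))

/-- The token after a block, by the value `m` of the counter. -/
theorem step_block {m : ℕ} {w W : List A.Token} {t : BlockToken} {bs : List BlockToken}
    (hW : W = Sum.inl BaseToken.bos :: w ++ (t :: bs).map fun b => Sum.inr (Sum.inr b))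
    (hw : Sum.inl BaseToken.bos ∉ w) (ht : A.value (Sum.inr (Sum.inr t)) = none)
    (hcarry : ((t :: bs).getLast (List.cons_ne_nil _ _)).carry = false)
    (hcopy : (A.toMachine c).pointer W (Sum.inr true) = w.length + 1)
    (hm : (A.toMachine c).pointer W (Sum.inr false) = m) :
    (A.toMachine c).step W = if m = 0 then Sum.inl BaseToken.ans
      else Sum.inr (Sum.inr BlockToken.dec) := by
  have hsplit : W = (Sum.inl BaseToken.bos :: w ++ (t :: bs).dropLast.map fun b =>
      Sum.inr (Sum.inr b)) ++ [Sum.inr (Sum.inr ((t :: bs).getLast (List.cons_ne_nil _ _)))] := by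
    have h := congrArg (List.map fun b => (Sum.inr (Sum.inr b) : A.Token))
      (List.dropLast_append_getLast (List.cons_ne_nil t bs))
    rw [List.map_append] at h
    rw [hW, List.append_assoc, ← h]
    rfl
  have h0 : (A.toMachine c).look W (Sum.inr true) = Sum.inr (Sum.inr t) :=
    look_eq (n := w.length + 1) (by rw [hcopy]; norm_cast) (by simp [hW])
  have h1 : (A.toMachine c).look W (Sum.inr false) = Sum.inl BaseToken.bos ↔ m = 0 := by
    rw [hW, List.cons_append, look_eq_bos_iff (by simpa using hw) (by simp),
      ← List.cons_append, ← hW, hm]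
    omega
  conv_lhs => rw [hsplit, step_append, ← hsplit]
  change A.nextBlock _ _ _ = _
  rw [hcarry, h0, nextBlock, ht]
  simp [h1]

/-- The digits `l` of the block `bs`, which is followed by `u`. -/
theorem exists_getElem_block {w W : List A.Token} {t : BlockToken} {bs : List BlockToken}
    {l : List Bool}
    (hW : W = Sum.inl BaseToken.bos :: w ++ (t :: bs).map fun b => Sum.inr (Sum.inr b))
    (hbs : bs.map (fun b => A.value (Sum.inr (Sum.inr b))) = l.map some) {u : A.Token}
    (hu : A.value u = none) (i : ℕ) (hi : i ≤ l.length) :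
    ∃ s, (W ++ [u])[w.length + 2 + i]? = some s ∧ A.value s = l[i]? := by
  have hlen : bs.length = l.length := by simpa using congrArg List.length hbs
  rcases hi.lt_or_eq with hi | rfl
  · have hib : i < bs.length := by omega
    refine ⟨Sum.inr (Sum.inr bs[i]), ?_, ?_⟩
    · have h : (List.map (fun b => (Sum.inr (Sum.inr b) : A.Token)) bs)[i]? =
          some (Sum.inr (Sum.inr bs[i])) := by simp [hib]
      rw [show w.length + 2 + i = (Sum.inl BaseToken.bos :: w).length + (i + 1) by
        simp; ring, hW, List.append_assoc, List.getElem?_append_right (by omega),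
        Nat.add_sub_cancel_left, List.map_cons, List.cons_append, List.getElem?_cons_succ,
        List.getElem?_append_left (List.getElem?_eq_some_iff.1 h).1, h]
    · have := congrArg (fun l => l[i]?) hbs
      simpa [hib, hi] using this
  · refine ⟨u, ?_, by simpa using hu⟩
    rw [show w.length + 2 + l.length = W.length by simp [hW, hlen]; ring]
    simp

/-- The blocks from some number on, followed by the output of the last number. Here `t` is a
delimiter followed by the block `bs` of the number `v`, and `m` is the value of the counter. -/
theorem generates_blocks (m v : ℕ) (w W : List A.Token) (t : BlockToken) (bs : List BlockToken)
    (hW : W = Sum.inl BaseToken.bos :: w ++ (t :: bs).map fun b => Sum.inr (Sum.inr b))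
    (hw : Sum.inl BaseToken.bos ∉ w) (ht : A.value (Sum.inr (Sum.inr t)) = none)
    (hbs : bs.map (fun b => A.value (Sum.inr (Sum.inr b))) = (Nat.bits v).map some)
    (hcarry : ((t :: bs).getLast (List.cons_ne_nil _ _)).carry = false)
    (hcopy : (A.toMachine c).pointer W (Sum.inr true) = w.length + 1)
    (hm : (A.toMachine c).pointer W (Sum.inr false) = m) :
    ∃ us : List BlockToken,
      (A.toMachine c).Generates W ((us.map fun b => Sum.inr (Sum.inr b)) ++ Sum.inl BaseToken.ans ::
          ((Nat.bits (v + m)).map fun b => Sum.inl (BaseToken.bit b)) ++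
            [Sum.inl BaseToken.eos]) := by
  induction m generalizing v w W t bs with
  | zero =>
    have hstep := step_block hW hw ht hcarry hcopy hm
    refine ⟨[], ⟨by simpa using hstep, ?_⟩⟩
    refine generates_output _ W _ (w.length + 2) (Or.inl rfl) ?_ (exists_getElem_block hW hbs rfl)
    rw [pointer_append, hcopy]
    simp [PointerMachine.pointer, copyWeight]
    ring
  | succ m ih =>
    have hlen : bs.length = (Nat.bits v).length := by simpa using congrArg List.length hbs
    have hstep := step_block hW hw ht hcarry hcopy hm
    have hcopy' : (A.toMachine c).pointer (W ++ [Sum.inr (Sum.inr BlockToken.dec)])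
        (Sum.inr true) = (w.length + 2 : ℕ) := by
      rw [pointer_append, hcopy]
      simp [PointerMachine.pointer, copyWeight]
      ring
    have hblock := generates_block _ W BlockToken.dec _ hcopy' (exists_getElem_block hW hbs rfl)
    set bs' := blockTokens BlockToken.dec.carry (Nat.bits v) with hbs'
    have hW' : (Sum.inl BaseToken.bos : A.Token) :: (w ++ (t :: bs).map fun b =>
        Sum.inr (Sum.inr b)) ++ ((BlockToken.dec :: bs').map fun b => Sum.inr (Sum.inr b)) =
        W ++ [Sum.inr (Sum.inr BlockToken.dec)] ++ bs'.map fun b => Sum.inr (Sum.inr b) := by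
      simp [hW]
    obtain ⟨us, hus⟩ := ih (v + 1) (w ++ (t :: bs).map fun b => Sum.inr (Sum.inr b))
      _ BlockToken.dec bs' hW'.symm (by simpa using hw) rfl
      (by rw [← addCarry_true_bits]; exact map_value_blockTokens _ _)
      (carry_getLast_blockTokens _ _)
      (by
        rw [pointer_append, hcopy', PointerMachine.pointer, List.map_map]
        change _ + (List.map (fun b => A.copyWeight (Sum.inr (Sum.inr b))) bs').sum = _
        rw [hbs', sum_copyWeight_blockTokens]
        simp [hlen]
        ring)
      (by
        rw [pointer_append, pointer_append, hm, PointerMachine.pointer,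
          PointerMachine.pointer, List.map_map]
        change _ + A.counterWeight c (Sum.inr (Sum.inr BlockToken.dec)) +
          (List.map (fun b => A.counterWeight c (Sum.inr (Sum.inr b))) bs').sum = _
        rw [hbs', sum_counterWeight_blockTokens]
        simp [counterWeight])
    refine ⟨BlockToken.dec :: bs' ++ us, ?_⟩
    rw [show v + (m + 1) = v + 1 + m by ring, List.map_append, List.append_assoc,
      List.append_assoc]
    refine ⟨by simpa using hstep, ?_⟩
    exact hblock.append (by simpa using hus)

/-- The prompt for `args`, without the start token, as a list of base tokens. -/
def argTokens (args : List (List Bool)) : List BaseToken :=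
  args.flatMap fun s => s.map BaseToken.bit ++ [BaseToken.sep]

theorem bos_notMem_argTokens (args : List (List Bool)) : BaseToken.bos ∉ argTokens args := by
  simp [argTokens]

theorem prompt_eq (T : DecoderOnlyTransformer) (args : List (List Bool)) :
    T.prompt args = (BaseToken.bos :: argTokens args).map Sum.inl := by
  simp [DecoderOnlyTransformer.prompt, DecoderOnlyTransformer.bitTokens, argTokens,
    List.map_flatMap, Function.comp_def]

theorem getLast_cons_argTokens (args : List (List Bool)) :
    (BaseToken.bos :: argTokens args).getLast (List.cons_ne_nil _ _) = BaseToken.bos ∨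
      (BaseToken.bos :: argTokens args).getLast (List.cons_ne_nil _ _) = BaseToken.sep := by
  induction args using List.reverseRecOn with
  | nil => exact Or.inl rfl
  | append_singleton args s _ =>
    right
    have : BaseToken.bos :: argTokens (args ++ [s]) =
        (BaseToken.bos :: (argTokens args ++ s.map BaseToken.bit)) ++ [BaseToken.sep] := by
      simp [argTokens]
    simp only [this, List.getLast_append_singleton]

/-- A transformer outputs the result of a counter program. -/
theorem outputs {args : List (List Bool)} {τ : ℕ → ℤ} {m : ℕ}
    (h : A.Exec (BaseToken.bos :: argTokens args) 0 τ) (hτ : τ c = m) :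
    (A.toMachine c).toTransformer.Outputs args m := by
  set P := BaseToken.bos :: argTokens args with hP
  have hbase : ∀ k (l : List BaseToken),
      ((l.map Sum.inl).map (A.counterWeight k)).sum = 0 := by
    intro k l
    rw [List.map_map]
    exact List.sum_eq_zero (by simp [counterWeight])
  have hstep : (A.toMachine c).step (P.map Sum.inl) = Sum.inr (Sum.inl A.entry) := by
    rw [hP, ← List.dropLast_append_getLast (List.cons_ne_nil BaseToken.bos (argTokens args)),
      List.map_append, List.map_singleton, step_append]
    rcases getLast_cons_argTokens args with h | h <;> rw [h]
  obtain ⟨us, hus, hc⟩ := generates_run (c := c) h [] (P.map Sum.inl ++ [Sum.inr (Sum.inl A.entry)])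
    rfl (by
      intro k
      rw [List.map_append, List.sum_append, hbase]
      simp only [List.map_singleton, List.sum_singleton, counterWeight, upd,
        Function.update_apply, Pi.zero_apply, zero_add])
  set w : List A.Token := (argTokens args).map Sum.inl ++
    (A.entry :: us).map fun q => Sum.inr (Sum.inl q) with hw
  have hW : (P.map Sum.inl ++ [Sum.inr (Sum.inl A.entry)]) ++
      ((us.map fun q => Sum.inr (Sum.inl q)) ++ [Sum.inr (Sum.inr BlockToken.zero)]) =
      (Sum.inl BaseToken.bos :: w ++
        [BlockToken.zero].map fun b => Sum.inr (Sum.inr b) : List A.Token) := by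
    simp [hP, hw]
  obtain ⟨bs, hbs⟩ := generates_blocks (c := c) m 0 w _ BlockToken.zero [] hW
    (by simp [hw, bos_notMem_argTokens]) rfl rfl rfl
    (by
      have hone : ∀ t ∈ w.map A.copyWeight, t = 1 := by
        intro t ht
        obtain ⟨u, hu, rfl⟩ := List.mem_map.1 ht
        rcases List.mem_append.1 hu with hu | hu
        · obtain ⟨b, hb, rfl⟩ := List.mem_map.1 hu
          cases b <;> first | rfl | exact absurd hb (bos_notMem_argTokens args)
        · obtain ⟨q, -, rfl⟩ := List.mem_map.1 hu
          rfl
      have hsum := List.sum_eq_card_nsmul _ _ hone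
      rw [hW, PointerMachine.pointer, List.map_append, List.map_cons, List.sum_append,
        List.sum_cons]
      change (0 : ℤ) + (w.map A.copyWeight).sum + 1 = _
      rw [hsum]
      simp)
    (by
      have := hc c
      rw [hτ] at this
      rw [← List.append_assoc, PointerMachine.pointer, List.map_append, List.sum_append]
      change (List.map (A.counterWeight c) _).sum + 0 = _
      rw [this, add_zero])
  refine ⟨(A.entry :: us).map (fun q => Sum.inr (Sum.inl q)) ++
    (BlockToken.zero :: bs).map (fun b => Sum.inr (Sum.inr b)), by simp, by simp, ?_⟩
  have hgen : (A.toMachine c).Generates (P.map Sum.inl) (Sum.inr (Sum.inl A.entry) ::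
      (((us.map fun q => Sum.inr (Sum.inl q)) ++ [Sum.inr (Sum.inr BlockToken.zero)]) ++ _)) :=
    ⟨hstep, hus.append hbs⟩
  rw [prompt_eq]
  convert PointerMachine.Generates.toTransformer (by simp [hP]) hgen using 1
  simp [DecoderOnlyTransformer.bitTokens]

end CounterProgram

/-! ### Primitive recursive functions of the prompt -/

/-- One step of parsing a prompt: the state consists of the bits read since the last separator
and of the arguments read before. -/
def parseStep : Option BaseToken → List Bool × List (List Bool) → List Bool × List (List Bool)
  | some (BaseToken.bit b), st => (st.1 ++ [b], st.2)
  | some BaseToken.sep, st => ([], st.2 ++ [st.1])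
  | _, st => st

theorem primrec_parseStep (s : Option BaseToken) : Primrec (parseStep s) := by
  have hbit : ∀ b : Bool, Primrec fun st : List Bool × List (List Bool) => (st.1 ++ [b], st.2) :=
    fun b => (Primrec.list_append.comp Primrec.fst (Primrec.const [b])).pair Primrec.snd
  have hsep : Primrec fun st : List Bool × List (List Bool) =>
      (([] : List Bool), st.2 ++ [st.1]) :=
    (Primrec.const []).pair (Primrec.list_concat.comp Primrec.snd Primrec.fst)
  rcases s with _ | (_ | b | _ | _ | _)
  · exact Primrec.id
  · exact Primrec.id
  · exact hbit b
  · exact hsep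
  · exact Primrec.id
  · exact Primrec.id

/-- Parsing a prompt yields the list of its arguments. -/
theorem foldl_parseStep (args done : List (List Bool)) :
    (CounterProgram.argTokens args).foldl (fun st t => parseStep (some t) st) ([], done) =
      ([], done ++ args) := by
  have hbits : ∀ (done : List (List Bool)) (s cur : List Bool), (s.map BaseToken.bit).foldl
      (fun st t => parseStep (some t) st) (cur, done) = (cur ++ s, done) := by
    intro done s
    induction s with
    | nil => simp
    | cons b s ih => intro cur; simpa [parseStep] using ih (cur ++ [b])
  induction args generalizing done with
  | nil => simp [CounterProgram.argTokens]
  | cons s args ih =>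
    have h : CounterProgram.argTokens (s :: args) =
        s.map BaseToken.bit ++ BaseToken.sep :: CounterProgram.argTokens args := by
      simp [CounterProgram.argTokens]
    have hbits : (s.map BaseToken.bit).foldl
      (fun st t => parseStep (some t) st) ([], done) = (s, done) := by simpa using hbits done s []
    rw [h, List.foldl_append, hbits, List.foldl_cons]
    simpa [parseStep] using ih (done ++ [s])

/-- Every primitive recursive function of lists of binary strings is computed by a transformer. -/
theorem exists_transformer_of_primrec {f : List (List Bool) → ℕ} (hf : Primrec f) :
    ∃ T : DecoderOnlyTransformer, ∀ args, T.Outputs args (f args) := by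
  let St := List Bool × List (List Bool)
  let dec : ℕ → St := fun n => (Encodable.decode n).getD ([], [])
  have hdec : Primrec dec := Primrec.option_getD.comp Primrec.decode (Primrec.const _)
  have hdec_encode : ∀ st : St, dec (Encodable.encode st) = st := fun st => by simp [dec]
  have h0 : Encodable.encode (([], []) : St) = 0 := rfl
  obtain ⟨A, hA⟩ := CounterProgram.exists_exec_foldl
    (g := fun s n => Encodable.encode (parseStep s (dec n))) (F := fun n => f (dec n).2)
    (fun s => Primrec.encode.comp ((primrec_parseStep s).comp hdec))
    (hf.comp (Primrec.snd.comp hdec))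
  refine ⟨(A.toMachine 3).toTransformer, fun args => ?_⟩
  obtain ⟨τ, hτ, h3⟩ := hA _ (CounterProgram.bos_notMem_argTokens args)
  have hfold : ∀ (l : List BaseToken) (st : St),
      l.foldl (fun n t => Encodable.encode (parseStep (some t) (dec n))) (Encodable.encode st) =
        Encodable.encode (l.foldl (fun st t => parseStep (some t) st) st) := by
    intro l
    induction l with
    | nil => simp
    | cons t l ih => intro st; simp only [List.foldl_cons, hdec_encode, ih]
  refine CounterProgram.outputs hτ ?_
  rw [h3, ← h0, hfold, foldl_parseStep, hdec_encode]
  rfl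

/-! ### Approximation of the conditional complexity from above -/

/-- The number with a given binary expansion, least significant bit first. -/
def ofBits (l : List Bool) : ℕ :=
  l.foldr Nat.bit 0

theorem ofBits_bits (n : ℕ) : ofBits (Nat.bits n) = n := by
  induction n using Nat.binaryRec' with
  | zero => rfl
  | bit b n hb ih =>
    rw [Nat.bits_append_bit _ _ hb]
    exact congrArg (Nat.bit b) ih

theorem primrec_ofBits : Primrec ofBits := by
  have h : Primrec₂ Nat.bit := by
    refine (Primrec.cond Primrec.fst
      (Primrec.nat_add.comp (Primrec.nat_mul.comp (Primrec.const 2) Primrec.snd) (Primrec.const 1))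
      (Primrec.nat_mul.comp (Primrec.const 2) Primrec.snd)).of_eq ?_
    rintro ⟨b, n⟩
    cases b <;> rfl
  exact Primrec.list_foldr Primrec.id (Primrec.const 0)
    (h.comp (Primrec.fst.comp Primrec.snd) (Primrec.snd.comp Primrec.snd)).to₂

open Nat.Partrec (Code)

/-- Stage `t` of the approximation, which improves the bound `m`: `t` encodes a program `p` and a
number `k`, and `p` is tried with `k` as the bound of `Nat.Partrec.Code.evaln`. -/
def approxStep (c : Code) (t : ℕ) (x y : List Bool) (m : ℕ) : ℕ :=
  match (Encodable.decode t : Option (List Bool × ℕ)) with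
  | none => m
  | some (p, k) =>
    if Code.evaln k c (Encodable.encode (p, y)) = some (Encodable.encode x) then min m p.length
    else m

/-- Upper bounds for the complexity of `x` given `y` with respect to the machine with the code `c`,
starting from the bound `x.length + d`. Every stage tries one program only, which makes the
bounds nonincreasing and primitive recursive. -/
def approx (c : Code) (d t : ℕ) (x y : List Bool) : ℕ :=
  Nat.rec (x.length + d) (fun t m => approxStep c t x y m) t

theorem primrec_approx (c : Code) (d : ℕ) :
    Primrec fun a : ℕ × List Bool × List Bool => approx c d a.1 a.2.1 a.2.2 := by
  refine Primrec.nat_rec' (f := fun a : ℕ × List Bool × List Bool => a.1)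
    (g := fun a => a.2.1.length + d)
    (h := fun a b => approxStep c b.1 a.2.1 a.2.2 b.2) Primrec.fst ?_ ?_
  · exact Primrec.nat_add.comp (Primrec.list_length.comp (Primrec.fst.comp Primrec.snd))
      (Primrec.const d)
  · let α := (ℕ × List Bool × List Bool) × ℕ × ℕ
    let β := List Bool × ℕ
    have hx : Primrec fun a : α × β => a.1.1.2.1 :=
      Primrec.fst.comp (Primrec.snd.comp (Primrec.fst.comp Primrec.fst))
    have hy : Primrec fun a : α × β => a.1.1.2.2 :=
      Primrec.snd.comp (Primrec.snd.comp (Primrec.fst.comp Primrec.fst))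
    have hm : Primrec fun a : α × β => a.1.2.2 :=
      Primrec.snd.comp (Primrec.snd.comp Primrec.fst)
    have hp : Primrec fun a : α × β => a.2.1 := Primrec.fst.comp Primrec.snd
    have hk : Primrec fun a : α × β => a.2.2 := Primrec.snd.comp Primrec.snd
    have hev : Primrec fun a : α × β =>
        Code.evaln a.2.2 c (Encodable.encode (a.2.1, a.1.1.2.2)) :=
      Code.primrec_evaln.comp ((hk.pair (Primrec.const c)).pair
        (Primrec.encode.comp (hp.pair hy)))
    have hite : Primrec fun a : α × β =>
        if Code.evaln a.2.2 c (Encodable.encode (a.2.1, a.1.1.2.2)) =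
          some (Encodable.encode a.1.1.2.1) then min a.1.2.2 a.2.1.length else a.1.2.2 :=
      Primrec.ite (Primrec.eq.comp hev (Primrec.option_some.comp (Primrec.encode.comp hx)))
        (Primrec.nat_min.comp hm (Primrec.list_length.comp hp)) hm
    have hd : Primrec fun a : α => (Encodable.decode a.2.1 : Option β) :=
      Primrec.decode.comp (Primrec.fst.comp Primrec.snd)
    refine (Primrec.option_casesOn hd (Primrec.snd.comp Primrec.snd) hite.to₂).of_eq ?_
    intro a
    simp only [approxStep, β]
    cases (Encodable.decode a.2.1 : Option (List Bool × ℕ)) <;> rfl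


theorem approx_succ_le (c : Code) (d t : ℕ) (x y : List Bool) :
    approx c d (t + 1) x y ≤ approx c d t x y := by
  change approxStep c t x y (approx c d t x y) ≤ _
  rw [approxStep]
  split
  · exact le_rfl
  · split_ifs
    · exact min_le_left _ _
    · exact le_rfl

theorem condComplexity_le {U : List Bool → List Bool →. List Bool} {p x y : List Bool}
    (h : x ∈ U p y) : condComplexity U x y ≤ p.length :=
  Nat.sInf_le ⟨p, h, rfl⟩

/-- If only programs for `x` are accepted, the approximation stays above the complexity. -/
theorem condComplexity_le_approx {U : List Bool → List Bool →. List Bool} {c : Code} {d : ℕ}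
    {x y : List Bool}
    (hc : ∀ p k, Code.evaln k c (Encodable.encode (p, y)) = some (Encodable.encode x) → x ∈ U p y)
    (hd : condComplexity U x y ≤ x.length + d) (t : ℕ) :
    condComplexity U x y ≤ approx c d t x y := by
  induction t with
  | zero => exact hd
  | succ t ih =>
    change _ ≤ approxStep c t x y (approx c d t x y)
    rw [approxStep]
    split
    · exact ih
    · split_ifs with h
      · exact le_min ih (condComplexity_le (hc _ _ h))
      · exact ih

/-- A program that outputs `x` is taken into account at the stage of its encoding. -/
theorem approx_le_length {c : Code} {p x y : List Bool} {k : ℕ}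
    (h : Code.evaln k c (Encodable.encode (p, y)) = some (Encodable.encode x)) (d : ℕ) :
    approx c d (Encodable.encode (p, k) + 1) x y ≤ p.length := by
  change approxStep c _ x y _ ≤ _
  rw [approxStep, Encodable.encodek]
  simp only [h, if_true]
  exact min_le_right _ _

/-- A code for the machine `U` on pairs of strings. -/
theorem exists_code_of_partrec {U : List Bool → List Bool →. List Bool} (hU : Partrec₂ U) :
    ∃ c : Code, ∀ p y x, (∃ k, Code.evaln k c (Encodable.encode (p, y)) =
      some (Encodable.encode x)) ↔ x ∈ U p y := by
  obtain ⟨c, hc⟩ := Code.exists_code.1 hU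
  refine ⟨c, fun p y x => ?_⟩
  have h := Code.evaln_complete (c := c) (n := Encodable.encode (p, y)) (x := Encodable.encode x)
  rw [hc] at h
  refine h.symm.trans ?_
  simp

/-- For every universal machine `U` there is a total recursive `M(t, x, y)`, nonincreasing in `t`
and with limit `C_U(x | y)` as `t → ∞`, that is computed by decoder-only transformers:
by one transformer that is given `t`, `x` and `y`, and by a sequence of transformers the `t`-th of
which is given `x` and `y`. -/
theorem corollary4p2 (U : List Bool → List Bool →. List Bool) (hU : IsUniversalMachine U) :
    ∃ M : ℕ → List Bool → List Bool → ℕ,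
      Computable (fun a : ℕ × List Bool × List Bool => M a.1 a.2.1 a.2.2) ∧
      (∀ x y, Antitone fun t => M t x y) ∧
      (∃ T : DecoderOnlyTransformer, ∀ t x y, T.Outputs [Nat.bits t, x, y] (M t x y)) ∧
      (∃ T : ℕ → DecoderOnlyTransformer, ∀ t x y, (T t).Outputs [x, y] (M t x y)) ∧
      ∀ x y, Tendsto (fun t => M t x y) atTop (𝓝 (condComplexity U x y)) := by
  obtain ⟨c, hc⟩ := exists_code_of_partrec hU.partrec
  obtain ⟨g, d, -, hlen, hg⟩ := hU.simulates (fun p _ => Part.some p) Computable.fst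
  have hprog : ∀ x y, x ∈ U (g x) y := fun x y => by rw [hg]; exact Part.mem_some x
  have hanti : ∀ x y, Antitone fun t => approx c d t x y := fun x y =>
    antitone_nat_of_succ_le fun t => approx_succ_le c d t x y
  have hprim := primrec_approx c d
  have hget : ∀ i, Primrec fun l : List (List Bool) => l.getD i [] := fun i =>
    (Primrec.list_getD []).comp Primrec.id (Primrec.const i)
  refine ⟨approx c d, hprim.to_comp, hanti, ?_, ?_, fun x y => ?_⟩
  · obtain ⟨T, hT⟩ := exists_transformer_of_primrec
      (f := fun l => approx c d (ofBits (l.getD 0 [])) (l.getD 1 []) (l.getD 2 []))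
      (hprim.comp ((primrec_ofBits.comp (hget 0)).pair ((hget 1).pair (hget 2))))
    refine ⟨T, fun t x y => ?_⟩
    simpa [ofBits_bits] using hT [Nat.bits t, x, y]
  · have h : ∀ t, ∃ T : DecoderOnlyTransformer, ∀ x y, T.Outputs [x, y] (approx c d t x y) := by
      intro t
      obtain ⟨T, hT⟩ := exists_transformer_of_primrec
        (f := fun l => approx c d t (l.getD 0 []) (l.getD 1 []))
        (hprim.comp ((Primrec.const t).pair ((hget 0).pair (hget 1))))
      exact ⟨T, fun x y => by simpa using hT [x, y]⟩
    choose T hT using h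
    exact ⟨T, hT⟩
  · obtain ⟨p, hp, hpl⟩ : ∃ p, x ∈ U p y ∧ p.length = condComplexity U x y :=
      Nat.sInf_mem (s := {n | ∃ p : List Bool, x ∈ U p y ∧ p.length = n})
        ⟨_, g x, hprog x y, rfl⟩
    obtain ⟨k, hk⟩ := (hc p y x).2 hp
    refine tendsto_const_nhds.congr' ?_
    filter_upwards [eventually_ge_atTop (Encodable.encode (p, k) + 1)] with t ht
    refine le_antisymm (condComplexity_le_approx (fun p k h => (hc p y x).1 ⟨k, h⟩)
      ((condComplexity_le (hprog x y)).trans (hlen x)) t) ?_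
    exact (hanti x y ht).trans ((approx_le_length hk d).trans hpl.le)
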